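/- For an odd prime $p$, let $T$ be the $p$-regular rooted tree whose vertices are the finite words over $\{0,\dots,p-1\}$, and let $G=\langle a,b\rangle\le\operatorname{Aut}T$ be the Gupta–Sidki $p$-group: $a$ cyclically permutes the $p$ subtrees rooted at the first level, $a(iw)=((i+1)\bmod p)\,w$, and $b=(a,a^{-1},1,\dots,1,b)$ fixes the first level and acts as $a$ on the subtree at $0$, as $a^{-1}$ on the subtree at $1$, as $b$ on the subtree at $p-1$, and trivially on the other first-level subtrees. Two groups are called commensurable if they have isomorphic subgroups of finite index. (1) Let $p$ be an odd prime, let $k\ge 0$, and let $G^k$ be the direct product of $k$ copies of the Gupta–Sidki $p$-group $G$. If $H$ is a group commensurable with $G^k$, then every maximal subgroup of $H$ has finite index in $H$. (2) If $H$ is a finitely generated subgroup of the Gupta–Sidki $3$-group, then every maximal subgroup of $H$ has finite index in $H$. -/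

import Mathlib

namespace GuptaSidki

/-- The regular rooted tree on the finite words over the alphabet `X`: the root is the empty word,
and two words are joined by an edge when one of them is the other followed by one letter. -/
def wordTree (X : Type*) : SimpleGraph (List X) where
  Adj u v := (∃ x, v = u ++ [x]) ∨ (∃ x, u = v ++ [x])
  symm := ⟨fun _ _ h => h.symm⟩
  loopless := ⟨fun u h => by rcases h with ⟨x, h⟩ | ⟨x, h⟩ <;> simp at h⟩

/-- The automorphism group of the tree of words: the permutations of the vertices that preserve
adjacency. Multiplication is composition. -/
abbrev AutTree (X : Type*) : Type _ := wordTree X ≃g wordTree X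

theorem adj_of_children {X : Type*} {f : List X → List X}
    (hf : ∀ u x, ∃ y, f (u ++ [x]) = f u ++ [y]) {u v : List X} (h : (wordTree X).Adj u v) :
    (wordTree X).Adj (f u) (f v) := by
  rcases h with ⟨x, rfl⟩ | ⟨x, rfl⟩
  · exact Or.inl (hf u x)
  · exact Or.inr (hf v x)

/-- Two mutually inverse maps on words that carry children to children form a tree automorphism. -/
def mkAut {X : Type*} (f g : List X → List X) (hgf : ∀ u, g (f u) = u) (hfg : ∀ u, f (g u) = u)
    (hf : ∀ u x, ∃ y, f (u ++ [x]) = f u ++ [y])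
    (hg : ∀ u x, ∃ y, g (u ++ [x]) = g u ++ [y]) : AutTree X where
  toFun := f
  invFun := g
  left_inv := hgf
  right_inv := hfg
  map_rel_iff' := by
    intro u v
    refine ⟨fun h => ?_, fun h => adj_of_children hf h⟩
    have h2 := adj_of_children hg h
    simpa [hgf] using h2

/-! From here on the alphabet `{0, …, p - 1}` is `ZMod p`, so that the last letter `p - 1` is `-1`. -/

/-- Add `k` to the first letter of a word. -/
def shift {p : ℕ} (k : ZMod p) : List (ZMod p) → List (ZMod p)
  | [] => []
  | i :: w => (i + k) :: w

theorem shift_shift {p : ℕ} {k l : ZMod p} (h : k + l = 0) (u : List (ZMod p)) :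
    shift l (shift k u) = u := by
  cases u with
  | nil => rfl
  | cons i w => simp [shift, add_assoc, h]

theorem shift_append {p : ℕ} (k : ZMod p) (u : List (ZMod p)) (x : ZMod p) :
    ∃ y, shift k (u ++ [x]) = shift k u ++ [y] := by
  cases u with
  | nil => exact ⟨x + k, rfl⟩
  | cons i w => exact ⟨x, rfl⟩

/-- The generator `a`: it cyclically permutes the `p` subtrees rooted at the first layer,
`a (i w) = (i + 1) w`. -/
def a (p : ℕ) : AutTree (ZMod p) :=
  mkAut (shift 1) (shift (-1)) (shift_shift (by simp)) (shift_shift (by simp))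
    (shift_append 1) (shift_append (-1))

/-- The map on words that fixes every first letter and acts below the first layer as
`(s, t, 1, …, 1, itself)`: as `s` below `0`, as `t` below `1`, as itself below the last letter
`p - 1`, and trivially below the other letters. -/
def spinal {p : ℕ} (s t : AutTree (ZMod p)) : List (ZMod p) → List (ZMod p)
  | [] => []
  | i :: w =>
    if i = 0 then i :: s w
    else if i = 1 then i :: t w
    else if i = -1 then i :: spinal s t w
    else i :: w

theorem spinal_spinal {p : ℕ} {s t s' t' : AutTree (ZMod p)} (hs : ∀ u, s' (s u) = u)
    (ht : ∀ u, t' (t u) = u) (u : List (ZMod p)) : spinal s' t' (spinal s t u) = u := by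
  induction u with
  | nil => rfl
  | cons i w ih =>
    by_cases h0 : i = 0
    · simp [spinal, h0, hs]
    by_cases h1 : i = 1
    · subst h1; simp [spinal, h0, ht]
    by_cases h2 : i = -1
    · subst h2; simp only [spinal, h0, h1, if_true, if_false, ih]
    · simp [spinal, h0, h1, h2]

theorem spinal_append {p : ℕ} {s t : AutTree (ZMod p)}
    (hs : ∀ u x, ∃ y, s (u ++ [x]) = s u ++ [y]) (ht : ∀ u x, ∃ y, t (u ++ [x]) = t u ++ [y])
    (hs0 : s [] = []) (ht0 : t [] = []) (u : List (ZMod p)) (x : ZMod p) :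
    ∃ y, spinal s t (u ++ [x]) = spinal s t u ++ [y] := by
  induction u with
  | nil => exact ⟨x, by simp [spinal, hs0, ht0]⟩
  | cons i w ih =>
    obtain ⟨y0, hy0⟩ := hs w x
    obtain ⟨y1, hy1⟩ := ht w x
    obtain ⟨y2, hy2⟩ := ih
    by_cases h0 : i = 0
    · exact ⟨y0, by simp [spinal, h0, hy0]⟩
    by_cases h1 : i = 1
    · exact ⟨y1, by subst h1; simp [spinal, h0, hy1]⟩
    by_cases h2 : i = -1
    · exact ⟨y2, by subst h2; simp [spinal, h0, h1, hy2]⟩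
    · exact ⟨x, by simp [spinal, h0, h1, h2]⟩

/-- The generator `b = (a, a⁻¹, 1, …, 1, b)`. -/
def b (p : ℕ) : AutTree (ZMod p) :=
  mkAut (spinal (a p) (a p)⁻¹) (spinal (a p)⁻¹ (a p))
    (spinal_spinal (fun u => (a p).left_inv u) (fun u => (a p).right_inv u))
    (spinal_spinal (fun u => (a p).right_inv u) (fun u => (a p).left_inv u))
    (spinal_append (shift_append 1) (shift_append (-1)) rfl rfl)
    (spinal_append (shift_append (-1)) (shift_append 1) rfl rfl)

end GuptaSidki

/-- The Gupta–Sidki `p`-group `⟨a, b⟩`, a subgroup of the automorphism group of the `p`-regular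
rooted tree. -/
def guptaSidkiGroup (p : ℕ) : Subgroup (GuptaSidki.AutTree (ZMod p)) :=
  Subgroup.closure {GuptaSidki.a p, GuptaSidki.b p}

/-- Abstract commensurability: `G` and `H` have isomorphic subgroups of finite index. -/
def AbstractlyCommensurable (G H : Type*) [Group G] [Group H] : Prop :=
  ∃ (K : Subgroup G) (L : Subgroup H), K.FiniteIndex ∧ L.FiniteIndex ∧ Nonempty (K ≃* L)

/-! A maximal subgroup of infinite index lies in no proper subgroup of finite index, that is, it is
dense in the profinite topology; so the aim is to exclude proper dense subgroups. This is carried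
together with residual finiteness of all quotients. The combined property `GroupIsTame` passes to
quotients, to finite subdirect products (by `ProDense.sup_inf_eq_top` and
`QuotientsResiduallyFinite.inf`) and from a subgroup of finite index to the whole group. Hence a
subgroup of `G` is tame when all its section groups `secSub` are (`groupIsTame_of_secSub`).

`G` is tame. It is residually finite, and it is just infinite because it branches over its
commutator subgroup, so every quotient is residually finite. Sections of a dense subgroup `M` are
dense, and if one of them is `G` then `M = G` (`eq_top_of_secSub`). Descending to sections shortens
an element of `M` with nonzero `b`-exponent until a conjugate of `b` appears; its sections supply
conjugates of both generators, and the conjugator is then shortened in the same way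
(`eq_top_of_conj_generators`).

Iterated sections of a normal subgroup of finite index reach `G`, so subgroups of finite index in
`G` are tame. Those of `G^k` are subdirect products of such groups, which gives (1).

For (2), induct on the length of generators, proving that all subgroups of finite index are tame. A
subgroup mapping onto the abelianization is `G` (`IsFull.eq_top`). If `H` moves the first level and
neither `H` nor its section is `G`, then for `p = 3` this forces the section to fix the first level.
A second section is then available, and it outweighs the growth of the Schreier generators. -/

set_option linter.unusedSectionVars false

/-! ### Dense subgroups and separable normal subgroups -/

namespace Subgroup

variable {H : Type*} [Group H]

/-- A subgroup is dense in the profinite topology when it lies in no proper subgroup of finite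
index. -/
def ProDense (M : Subgroup H) : Prop :=
  ∀ F : Subgroup H, M ≤ F → F.FiniteIndex → F = ⊤

/-- A subgroup is closed in the profinite topology when it is an intersection of subgroups of
finite index. -/
def ProClosed (C : Subgroup H) : Prop :=
  ∀ x ∉ C, ∃ F : Subgroup H, F.FiniteIndex ∧ C ≤ F ∧ x ∉ F

/-- All quotients of `H ⧸ N` are residually finite. -/
def QuotientsResiduallyFinite (N : Subgroup H) : Prop :=
  ∀ C : Subgroup H, C.Normal → N ≤ C → C.ProClosed

theorem relIndex_ne_zero_of_index_ne_zero {F : Subgroup H} (hF : F.FiniteIndex) (K : Subgroup H) :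
    F.relIndex K ≠ 0 :=
  fun h => hF.1 (Subgroup.index_eq_zero_of_relIndex_eq_zero h)

theorem finiteIndex_comap {K : Type*} [Group K] {F : Subgroup K} (hF : F.FiniteIndex)
    (f : H →* K) : (F.comap f).FiniteIndex :=
  ⟨by rw [Subgroup.index_comap]; exact relIndex_ne_zero_of_index_ne_zero hF _⟩

/-- Every coset of `F` has a representative in `N`, so the cosets of `F ⊓ N` in `N` map onto `H ⧸
F`. -/
theorem finiteIndex_of_sup_eq_top {F N : Subgroup H} [N.Normal] (h : F ⊔ N = ⊤)
    (hr : F.relIndex N ≠ 0) : F.FiniteIndex := by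
  have : (F.subgroupOf N).FiniteIndex := ⟨hr⟩
  have : Finite (N ⧸ F.subgroupOf N) := Subgroup.finite_quotient_of_finiteIndex
  have hf : ∀ x y : N, QuotientGroup.leftRel (F.subgroupOf N) x y →
      (QuotientGroup.mk (x : H) : H ⧸ F) = QuotientGroup.mk (y : H) := by
    intro x y hxy
    rw [QuotientGroup.leftRel_apply] at hxy
    rw [QuotientGroup.eq]
    simpa [Subgroup.mem_subgroupOf] using hxy
  have : Finite (H ⧸ F) := by
    refine Finite.of_surjective (Quotient.lift (fun x : N => (QuotientGroup.mk (x : H) : H ⧸ F)) hf)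
      fun q => ?_
    induction q using QuotientGroup.induction_on with
    | H x =>
      have hx : x ∈ N ⊔ F := by rw [sup_comm, h]; trivial
      obtain ⟨n, hn, f, hf', rfl⟩ := Subgroup.mem_sup_of_normal_left.1 hx
      refine ⟨Quotient.mk _ ⟨n, hn⟩, ?_⟩
      change (QuotientGroup.mk n : H ⧸ F) = _
      rw [QuotientGroup.eq]
      simpa using hf'
  exact Subgroup.finiteIndex_of_finite_quotient

theorem ProDense.eq_top {M : Subgroup H} (hM : M.ProDense) (h : M.FiniteIndex) : M = ⊤ :=
  hM M le_rfl h

theorem ProDense.map {K : Type*} [Group K] {M : Subgroup H} (hM : M.ProDense) {f : H →* K}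
    (hf : Function.Surjective f) : (M.map f).ProDense := by
  intro F hF hfin
  have := hM (F.comap f) (Subgroup.map_le_iff_le_comap.1 hF) (finiteIndex_comap hfin f)
  rw [eq_top_iff]
  intro x _
  obtain ⟨y, rfl⟩ := hf x
  have : y ∈ F.comap f := by rw [this]; trivial
  exact this

theorem ProDense.sup_eq_top {M N : Subgroup H} (hM : M.ProDense) (hN : N.FiniteIndex) :
    M ⊔ N = ⊤ :=
  hM _ le_sup_left (Subgroup.finiteIndex_of_le le_sup_right)

/-- For `F` of finite index in `K` containing `M ⊓ K`, the core `N` of `F` in `H` satisfies `M N =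
H`; writing `k = m n` forces `m ∈ K`, because `N ≤ F ≤ K`. -/
theorem ProDense.subgroupOf {M : Subgroup H} (hM : M.ProDense) (K : Subgroup H)
    [K.FiniteIndex] : (M.subgroupOf K).ProDense := by
  intro F hF hfin
  have hFi : (F.map K.subtype).FiniteIndex := by
    constructor
    rw [Subgroup.index_map_subtype]
    exact mul_ne_zero hfin.1 Subgroup.FiniteIndex.index_ne_zero
  set N := (F.map K.subtype).normalCore with hN
  have hNF : N ≤ F.map K.subtype := Subgroup.normalCore_le _
  have hsup : M ⊔ N = ⊤ := hM.sup_eq_top inferInstance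
  rw [eq_top_iff]
  rintro k -
  have hk : (k : H) ∈ M ⊔ N := by rw [hsup]; trivial
  obtain ⟨m, hm, n, hn, hmn⟩ := Subgroup.mem_sup_of_normal_right.1 hk
  obtain ⟨f, hf, hfn⟩ := hNF hn
  have hmK : m ∈ K := by
    have : m = (k : H) * (f : H)⁻¹ := by
      rw [← hmn, ← hfn]; simp
    rw [this]
    exact K.mul_mem k.2 (K.inv_mem f.2)
  have hmF : (⟨m, hmK⟩ : K) ∈ F := hF (by simpa [Subgroup.mem_subgroupOf] using hm)
  have : k = ⟨m, hmK⟩ * f := by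
    ext; simp [← hmn, ← hfn]
  rw [this]
  exact F.mul_mem hmF hf

theorem ProClosed.exists_normal {C : Subgroup H} (hC : C.ProClosed) [hn : C.Normal] {x : H}
    (hx : x ∉ C) : ∃ L : Subgroup H, L.Normal ∧ L.FiniteIndex ∧ C ≤ L ∧ x ∉ L := by
  obtain ⟨F, hF, hCF, hxF⟩ := hC x hx
  exact ⟨F.normalCore, inferInstance, inferInstance, Subgroup.normal_le_normalCore.2 hCF,
    fun h => hxF (Subgroup.normalCore_le _ h)⟩

theorem ProClosed.of_finiteIndex {C : Subgroup H} (h : C.FiniteIndex) : C.ProClosed :=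
  fun _ hx => ⟨C, h, le_rfl, hx⟩

/-- The subgroup `C = (M ⊓ N₂) N₁` is normal because `M` normalizes both factors and `M N₁ = H`.
Residual finiteness of `H ⧸ C` and density give `N₂ ≤ C`, and the modular law then yields `N₂ = (M ⊓
N₂) (N₁ ⊓ N₂)`. -/
theorem ProDense.sup_inf_eq_top {M N₁ N₂ : Subgroup H} [N₁.Normal] [N₂.Normal]
    (hq : N₁.QuotientsResiduallyFinite) (hM : M.ProDense) (h₁ : M ⊔ N₁ = ⊤) (h₂ : M ⊔ N₂ = ⊤) :
    M ⊔ (N₁ ⊓ N₂) = ⊤ := by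
  have hCn : ((M ⊓ N₂) ⊔ N₁).Normal := by
    constructor
    intro n hn g
    have hg : g ∈ M ⊔ N₁ := by rw [h₁]; trivial
    obtain ⟨m, hm, k, hk, rfl⟩ := Subgroup.mem_sup_of_normal_right.1 hg
    obtain ⟨c, hc, l, hl, rfl⟩ := Subgroup.mem_sup_of_normal_right.1 hn
    have hk' : k ∈ (M ⊓ N₂) ⊔ N₁ := (le_sup_right : N₁ ≤ _) hk
    have hin : k * (c * l) * k⁻¹ ∈ (M ⊓ N₂) ⊔ N₁ :=
      Subgroup.mul_mem _ (Subgroup.mul_mem _ hk' hn) (Subgroup.inv_mem _ hk')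
    obtain ⟨c', hc', l', hl', h'⟩ := Subgroup.mem_sup_of_normal_right.1 hin
    have : m * k * (c * l) * (m * k)⁻¹ = (m * c' * m⁻¹) * (m * l' * m⁻¹) := by
      calc _ = m * (k * (c * l) * k⁻¹) * m⁻¹ := by group
        _ = m * (c' * l') * m⁻¹ := by rw [h']
        _ = _ := by group
    rw [this]
    refine Subgroup.mul_mem_sup ⟨?_, ?_⟩ ?_
    · exact M.mul_mem (M.mul_mem hm hc'.1) (M.inv_mem hm)
    · exact Normal.conj_mem ‹_› _ hc'.2 _
    · exact Normal.conj_mem ‹_› _ hl' _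
  have key : N₂ ≤ M ⊔ (N₁ ⊓ N₂) := by
    intro h hh
    have hC : h ∈ (M ⊓ N₂) ⊔ N₁ := by
      by_contra hnot
      obtain ⟨L, hLn, hLf, hCL, hhL⟩ := (hq _ hCn le_sup_right).exists_normal hnot
      -- `M (L ⊓ N₂)` has finite index in `M N₂ = H`, so density makes it all of `H`.
      have hF : (M ⊔ (L ⊓ N₂)).FiniteIndex := by
        have hr : (L ⊓ N₂).relIndex N₂ ≠ 0 := by
          rw [Subgroup.inf_relIndex_right]
          exact relIndex_ne_zero_of_index_ne_zero hLf _
        have hr2 : (M ⊔ (L ⊓ N₂)).relIndex N₂ ≠ 0 :=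
          ne_zero_of_dvd_ne_zero hr (Subgroup.relIndex_dvd_of_le_left _ le_sup_right)
        refine finiteIndex_of_sup_eq_top (N := N₂) ?_ hr2
        rw [eq_top_iff, ← h₂]
        exact sup_le (le_sup_left.trans le_sup_left) le_sup_right
      have hh' : h ∈ M ⊔ (L ⊓ N₂) := by
        rw [hM _ le_sup_left hF]; trivial
      obtain ⟨m, hm, y, hy, hmy⟩ := Subgroup.mem_sup_of_normal_right.1 hh'
      have hmN : m ∈ N₂ := by
        have : m = h * y⁻¹ := by rw [← hmy]; group
        rw [this]
        exact N₂.mul_mem hh (N₂.inv_mem hy.2)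
      have hmL : m ∈ L := hCL ((le_sup_left : M ⊓ N₂ ≤ _) ⟨hm, hmN⟩)
      exact hhL (hmy ▸ L.mul_mem hmL hy.1)
    obtain ⟨m, hm, n, hn, rfl⟩ := Subgroup.mem_sup_of_normal_right.1 hC
    refine Subgroup.mul_mem_sup hm.1 ⟨hn, ?_⟩
    have := N₂.mul_mem (N₂.inv_mem hm.2) hh
    simpa using this
  rw [eq_top_iff, ← h₂]
  exact sup_le le_sup_left key

/-- Intersect subgroups separating from `U` the finitely many representatives of cosets of `U ⊓ V`
in `V`. -/
theorem ProClosed.exists_inf_le {U V : Subgroup H} (hU : U.ProClosed) (hUV : U.relIndex V ≠ 0) :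
    ∃ L : Subgroup H, L.FiniteIndex ∧ U ≤ L ∧ L ⊓ V ≤ U := by
  classical
  have : Finite (V ⧸ U.subgroupOf V) := by
    have : (U.subgroupOf V).FiniteIndex := ⟨hUV⟩
    exact Subgroup.finite_quotient_of_finiteIndex
  have hch : ∀ q : V ⧸ U.subgroupOf V, ∃ F : Subgroup H, F.FiniteIndex ∧ U ≤ F ∧
      (((q.out : V) : H) ∉ U → ((q.out : V) : H) ∉ F) := by
    intro q
    by_cases hq : ((q.out : V) : H) ∈ U
    · exact ⟨⊤, inferInstance, le_top, fun h => absurd hq h⟩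
    · obtain ⟨F, h1, h2, h3⟩ := hU _ hq
      exact ⟨F, h1, h2, fun _ => h3⟩
  choose F hF hUF hout using hch
  refine ⟨⨅ q, F q, Subgroup.finiteIndex_iInf hF, le_iInf hUF, ?_⟩
  rintro x ⟨hx, hxV⟩
  set q : V ⧸ U.subgroupOf V := QuotientGroup.mk ⟨x, hxV⟩
  have hq : (q.out)⁻¹ * (⟨x, hxV⟩ : V) ∈ U.subgroupOf V :=
    QuotientGroup.eq.1 (Quotient.out_eq' q)
  have hq' : ((q.out : V) : H)⁻¹ * x ∈ U := by simpa [Subgroup.mem_subgroupOf] using hq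
  have hxq : x ∈ F q := (Subgroup.mem_iInf.1 hx) q
  have ho : ((q.out : V) : H) ∈ F q := by
    have := (F q).mul_mem hxq ((F q).inv_mem (hUF q hq'))
    simpa using this
  have hoU : ((q.out : V) : H) ∈ U := by
    by_contra h
    exact hout q h ho
  have := U.mul_mem hoU hq'
  simpa using this

/-- Outside `C N₁` the hypothesis on `N₁` separates, so only `e ∈ N₁` outside `C` matters. Such an
`e` avoids `(C ⊓ N₁) N₂`, and `N₂` provides a separating `L`. As `C L` may still contain `e`, `L` is
first cut by an `L'` that meets `C` inside `(C ⊓ L) N₁`. -/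
theorem QuotientsResiduallyFinite.inf {N₁ N₂ : Subgroup H} [N₁.Normal] [N₂.Normal]
    (h₁ : N₁.QuotientsResiduallyFinite) (h₂ : N₂.QuotientsResiduallyFinite) :
    (N₁ ⊓ N₂).QuotientsResiduallyFinite := by
  intro C hC hNC e₀ he₀
  by_cases hs : e₀ ∈ C ⊔ N₁
  swap
  · obtain ⟨F, hF, hCF, hx⟩ := h₁ (C ⊔ N₁) inferInstance le_sup_right e₀ hs
    exact ⟨F, hF, le_sup_left.trans hCF, hx⟩
  obtain ⟨c₀, hc₀, e, he, rfl⟩ := Subgroup.mem_sup_of_normal_right.1 hs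
  have heC : e ∉ C := fun h => he₀ (C.mul_mem hc₀ h)
  suffices h : ∃ F : Subgroup H, F.FiniteIndex ∧ C ≤ F ∧ e ∉ F by
    obtain ⟨F, hF, hCF, hx⟩ := h
    exact ⟨F, hF, hCF, fun h => hx ((Subgroup.mul_mem_cancel_left F (hCF hc₀)).1 h)⟩
  have hE : e ∉ (C ⊓ N₁) ⊔ N₂ := by
    intro h
    obtain ⟨k, hk, n, hn, rfl⟩ := Subgroup.mem_sup_of_normal_right.1 h
    have hnN : n ∈ N₁ := (Subgroup.mul_mem_cancel_left N₁ hk.2).1 he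
    exact heC (C.mul_mem hk.1 (hNC ⟨hnN, hn⟩))
  obtain ⟨L, hLn, hLf, hEL, heL⟩ := (h₂ _ inferInstance le_sup_right).exists_normal hE
  have hrel : ((C ⊓ L) ⊔ N₁).relIndex C ≠ 0 := by
    refine ne_zero_of_dvd_ne_zero ?_ (Subgroup.relIndex_dvd_of_le_left C
      (le_sup_left : C ⊓ L ≤ (C ⊓ L) ⊔ N₁))
    rw [Subgroup.inf_relIndex_left]
    exact relIndex_ne_zero_of_index_ne_zero hLf _
  obtain ⟨L', hLf', hL', hLC'⟩ :=
    (h₁ ((C ⊓ L) ⊔ N₁) inferInstance le_sup_right).exists_inf_le hrel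
  refine ⟨C ⊔ (L ⊓ L'), Subgroup.finiteIndex_of_le le_sup_right, le_sup_left, ?_⟩
  intro heF
  obtain ⟨c, hc, y, hy, hcy⟩ := Subgroup.mem_sup_of_normal_left.1 heF
  have hcL' : c ∈ L' := by
    have : c = e * y⁻¹ := by rw [← hcy]; group
    rw [this]
    exact L'.mul_mem (hL' ((le_sup_right : N₁ ≤ _) he)) (L'.inv_mem hy.2)
  obtain ⟨c₁, hc₁, n, hn, rfl⟩ := Subgroup.mem_sup_of_normal_right.1 (hLC' ⟨hcL', hc⟩)
  have hnC : n ∈ C := (Subgroup.mul_mem_cancel_left C hc₁.1).1 hc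
  have hnL : n ∈ L := hEL ((le_sup_left : C ⊓ N₁ ≤ _) ⟨hnC, hn⟩)
  exact heL (hcy ▸ L.mul_mem (L.mul_mem hc₁.2 hnL) hy.1)

theorem QuotientsResiduallyFinite.finset_inf {ι : Type*} {N : ι → Subgroup H}
    (hn : ∀ i, (N i).Normal) (h : ∀ i, (N i).QuotientsResiduallyFinite) (s : Finset ι) :
    (s.inf N).Normal ∧ (s.inf N).QuotientsResiduallyFinite := by
  classical
  induction s using Finset.induction_on with
  | empty =>
    refine ⟨by rw [Finset.inf_empty]; infer_instance, fun C _ hC => ?_⟩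
    simp only [Finset.inf_empty, top_le_iff] at hC
    subst hC
    exact fun x hx => absurd trivial hx
  | insert i s _ ih =>
    have := hn i
    have := ih.1
    rw [Finset.inf_insert]
    exact ⟨inferInstance, (h i).inf ih.2⟩

theorem ProDense.sup_finset_inf_eq_top {ι : Type*} {N : ι → Subgroup H}
    (hn : ∀ i, (N i).Normal) (h : ∀ i, (N i).QuotientsResiduallyFinite) {M : Subgroup H}
    (hM : M.ProDense) (hsup : ∀ i, M ⊔ N i = ⊤) (s : Finset ι) : M ⊔ s.inf N = ⊤ := by
  classical
  induction s using Finset.induction_on with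
  | empty => simp
  | insert i s _ ih =>
    have := hn i
    have := (QuotientsResiduallyFinite.finset_inf hn h s).1
    rw [Finset.inf_insert]
    exact hM.sup_inf_eq_top (h i) (hsup i) ih

theorem quotientsResiduallyFinite_ker {K : Type*} [Group K]
    (h : ∀ C : Subgroup K, C.Normal → C.ProClosed) {f : H →* K}
    (hf : Function.Surjective f) : f.ker.QuotientsResiduallyFinite := by
  intro C hC hker x hx
  have hn : (C.map f).Normal := hC.map f hf
  have hxC : f x ∉ C.map f := by
    intro hm
    have : x ∈ (C.map f).comap f := hm
    rw [Subgroup.comap_map_eq_self hker] at this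
    exact hx this
  obtain ⟨F, hF, hCF, hy⟩ := h _ hn _ hxC
  exact ⟨F.comap f, finiteIndex_comap hF f, Subgroup.map_le_iff_le_comap.1 hCF, hy⟩

end Subgroup

/-- A group without proper dense subgroups, all of whose quotients are residually finite. -/
structure GroupIsTame (H : Type*) [Group H] : Prop where
  eq_top : ∀ M : Subgroup H, M.ProDense → M = ⊤
  closed : ∀ C : Subgroup H, C.Normal → C.ProClosed

/-! ### Permanence properties of tame groups -/

namespace GroupIsTame

open Subgroup

variable {H K : Type*} [Group H] [Group K]

theorem finiteIndex_of_isCoatom (h : GroupIsTame H) {M : Subgroup H} (hM : IsCoatom M) :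
    M.FiniteIndex := by
  by_contra hfin
  refine hM.1 (h.eq_top M fun F hF hFf => ?_)
  rcases eq_or_lt_of_le hF with rfl | hlt
  · exact absurd hFf hfin
  · exact hM.2 F hlt

theorem of_finite [Finite H] : GroupIsTame H :=
  ⟨fun _ hM => hM.eq_top inferInstance, fun _ _ => ProClosed.of_finiteIndex inferInstance⟩

theorem of_surjective (h : GroupIsTame H) {f : H →* K} (hf : Function.Surjective f) :
    GroupIsTame K := by
  constructor
  · intro M hM
    have : (M.comap f) = ⊤ := by
      refine h.eq_top _ fun F hF hFf => ?_
      have hker : f.ker ≤ F := le_trans (by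
        intro x hx; rw [MonoidHom.mem_ker] at hx; simp [Subgroup.mem_comap, hx, M.one_mem]) hF
      have hFm : (F.map f).FiniteIndex := by
        constructor
        rw [Subgroup.index_map_eq F hf hker]
        exact hFf.1
      have hMF : M ≤ F.map f := by
        rw [← Subgroup.map_comap_eq_self_of_surjective hf M]
        exact Subgroup.map_mono hF
      have := hM _ hMF hFm
      rw [← Subgroup.comap_map_eq_self hker, this, Subgroup.comap_top]
    rw [← Subgroup.map_comap_eq_self_of_surjective hf M, this]
    exact Subgroup.map_top_of_surjective f hf
  · intro C hC x hx
    obtain ⟨y, rfl⟩ := hf x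
    obtain ⟨F, hF, hCF, hy⟩ := h.closed (C.comap f) inferInstance y hx
    have hker : f.ker ≤ F := le_trans (by
        intro x hx; rw [MonoidHom.mem_ker] at hx; simp [Subgroup.mem_comap, hx, C.one_mem]) hCF
    refine ⟨F.map f, ⟨?_⟩, ?_, ?_⟩
    · rw [Subgroup.index_map_eq F hf hker]
      exact hF.1
    · rw [← Subgroup.map_comap_eq_self_of_surjective hf C]
      exact Subgroup.map_mono hCF
    · intro hm
      have : y ∈ (F.map f).comap f := hm
      rw [Subgroup.comap_map_eq_self hker] at this
      exact hy this

theorem of_mulEquiv (h : GroupIsTame H) (e : H ≃* K) : GroupIsTame K :=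
  h.of_surjective (f := e.toMonoidHom) e.surjective

/-- A subdirect product of finitely many tame groups is tame. -/
theorem of_subdirect {ι : Type*} [Finite ι] {A : ι → Type*} [∀ i, Group (A i)]
    (hA : ∀ i, GroupIsTame (A i)) (f : ∀ i, H →* A i) (hf : ∀ i, Function.Surjective (f i))
    (hinj : ∀ x, (∀ i, f i x = 1) → x = 1) : GroupIsTame H := by
  have := Fintype.ofFinite ι
  have hn : ∀ i, ((f i).ker).Normal := fun i => inferInstance
  have hq : ∀ i, ((f i).ker).QuotientsResiduallyFinite := fun i =>
    quotientsResiduallyFinite_ker (hA i).closed (hf i)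
  have hbot : Finset.univ.inf (fun i => (f i).ker) = ⊥ := by
    rw [eq_bot_iff]
    intro x hx
    rw [Finset.inf_univ_eq_iInf, Subgroup.mem_iInf] at hx
    exact hinj x hx
  constructor
  · intro M hM
    have := hM.sup_finset_inf_eq_top hn hq (fun i => ?_) Finset.univ
    · rwa [hbot, sup_bot_eq] at this
    · have h1 := (hA i).eq_top _ (hM.map (hf i))
      rw [← Subgroup.comap_map_eq, h1, Subgroup.comap_top]
  · intro C hC
    exact (QuotientsResiduallyFinite.finset_inf hn hq Finset.univ).2 C hC (by rw [hbot]; exact bot_le)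

/-- For closedness, reduce to `y ∈ L` and separate it from `C ⊓ L` inside `L` by some `F`; then `C
F` works, because `C F ⊓ L` stays inside `F`. -/
theorem of_subgroup {L : Subgroup H} [L.FiniteIndex] (h : GroupIsTame L) : GroupIsTame H := by
  constructor
  · intro M hM
    have h1 := h.eq_top _ (hM.subgroupOf L)
    rw [Subgroup.subgroupOf_eq_top] at h1
    exact hM.eq_top (Subgroup.finiteIndex_of_le h1)
  · intro C hC x hx
    by_cases hs : x ∈ C ⊔ L.normalCore
    swap
    · exact ⟨_, Subgroup.finiteIndex_of_le le_sup_right, le_sup_left, hs⟩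
    obtain ⟨c, hc, y, hy, rfl⟩ := Subgroup.mem_sup_of_normal_right.1 hs
    have hyL : y ∈ L := Subgroup.normalCore_le _ hy
    have hyC : (⟨y, hyL⟩ : L) ∉ C.subgroupOf L := fun h => hx (C.mul_mem hc h)
    obtain ⟨F, hF, hCF, hyF⟩ := h.closed (C.subgroupOf L) inferInstance _ hyC
    have hFi : (F.map L.subtype).FiniteIndex := by
      constructor
      rw [Subgroup.index_map_subtype]
      exact mul_ne_zero hF.1 Subgroup.FiniteIndex.index_ne_zero
    refine ⟨C ⊔ F.map L.subtype, Subgroup.finiteIndex_of_le le_sup_right, le_sup_left, ?_⟩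
    intro hm
    have hm' : y ∈ C ⊔ F.map L.subtype :=
      (Subgroup.mul_mem_cancel_left _ ((le_sup_left : C ≤ _) hc)).1 hm
    obtain ⟨d, hd, z, ⟨w, hw, rfl⟩, hdz⟩ := Subgroup.mem_sup_of_normal_left.1 hm'
    have hdL : d ∈ L := by
      have : d = y * (w : H)⁻¹ := by rw [← hdz]; simp
      rw [this]
      exact L.mul_mem hyL (L.inv_mem w.2)
    have hdF : (⟨d, hdL⟩ : L) ∈ F := hCF hd
    refine hyF ?_
    have : (⟨y, hyL⟩ : L) = ⟨d, hdL⟩ * w := by ext; simpa using hdz.symm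
    rw [this]
    exact F.mul_mem hdF hw

theorem of_le {N L : Subgroup H} (hNL : N ≤ L) (hr : N.relIndex L ≠ 0) (h : GroupIsTame N) :
    GroupIsTame L := by
  have : (N.subgroupOf L).FiniteIndex := ⟨hr⟩
  exact of_subgroup (L := N.subgroupOf L) (h.of_mulEquiv (Subgroup.subgroupOfEquivOfLe hNL).symm)

end GroupIsTame

/-! ### The wreath recursion -/

namespace GuptaSidki

/-- The Gupta–Sidki group as a type. -/
abbrev GSGroup (p : ℕ) : Type := ↥(guptaSidkiGroup p)

variable {p : ℕ}

/-- The generator `a` as an element of the group. -/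
def genA (p : ℕ) : GSGroup p := ⟨a p, Subgroup.subset_closure (Or.inl rfl)⟩

/-- The generator `b` as an element of the group. -/
def genB (p : ℕ) : GSGroup p := ⟨b p, Subgroup.subset_closure (Or.inr rfl)⟩

theorem closure_generators : Subgroup.closure {genA p, genB p} = ⊤ := by
  rw [eq_top_iff]
  have h : Subgroup.closure (Subtype.val ⁻¹' ({a p, b p} : Set (AutTree (ZMod p)))) =
      (⊤ : Subgroup (GSGroup p)) := Subgroup.closure_closure_coe_preimage
  rw [← h, Subgroup.closure_le]
  rintro ⟨x, hx⟩ (h | h)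
  · exact Subgroup.subset_closure (Or.inl (Subtype.ext h))
  · exact Subgroup.subset_closure (Or.inr (Subtype.ext h))

theorem eq_top_of_generators {M : Subgroup (GSGroup p)} (hA : genA p ∈ M) (hB : genB p ∈ M) :
    M = ⊤ := by
  rw [eq_top_iff, ← closure_generators, Subgroup.closure_le]
  rintro x (rfl | rfl)
  · exact hA
  · exact hB

@[elab_as_elim]
theorem generators_induction {P : GSGroup p → Prop} (hA : P (genA p)) (hB : P (genB p))
    (h1 : P 1) (hmul : ∀ x y, P x → P y → P (x * y)) (hinv : ∀ x, P x → P x⁻¹)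
    (g : GSGroup p) : P g := by
  have hg : g ∈ Subgroup.closure {genA p, genB p} := by rw [closure_generators]; trivial
  induction hg using Subgroup.closure_induction with
  | mem x hx =>
    rcases hx with rfl | rfl
    · exact hA
    · exact hB
  | one => exact h1
  | mul x y _ _ hx hy => exact hmul x y hx hy
  | inv x _ hx => exact hinv x hx

/-- The image of a word. -/
def act (g : GSGroup p) (w : List (ZMod p)) : List (ZMod p) := (g : AutTree (ZMod p)) w

@[simp] theorem act_mul (g h : GSGroup p) (w) : act (g * h) w = act g (act h w) := rfl

@[simp] theorem act_one (w) : act (1 : GSGroup p) w = w := rfl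

theorem act_inv_act (g : GSGroup p) (w) : act g⁻¹ (act g w) = w := by
  rw [← act_mul, inv_mul_cancel, act_one]

theorem act_act_inv (g : GSGroup p) (w) : act g (act g⁻¹ w) = w := by
  rw [← act_mul, mul_inv_cancel, act_one]

theorem act_ext {g h : GSGroup p} (H : ∀ w, act g w = act h w) : g = h :=
  Subtype.ext (RelIso.ext H)

theorem act_genA_cons (i : ZMod p) (w) : act (genA p) (i :: w) = (i + 1) :: w := rfl

open Classical in
/-- The sections of `b`. -/
noncomputable def secB (i : ZMod p) : GSGroup p :=
  if i = 0 then genA p else if i = 1 then (genA p)⁻¹ else if i = -1 then genB p else 1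

theorem act_genB_cons (i : ZMod p) (w) : act (genB p) (i :: w) = i :: act (secB i) w := by
  change spinal (a p) (a p)⁻¹ (i :: w) = _
  unfold spinal secB
  split_ifs <;> rfl

theorem act_nil (g : GSGroup p) : act g [] = [] := by
  induction g using generators_induction with
  | hA => rfl
  | hB => rfl
  | h1 => rfl
  | hmul x y hx hy => rw [act_mul, hy, hx]
  | hinv x hx => conv_lhs => rw [← hx, act_inv_act]

/-- Self-similarity: the sections of the generators lie in the group, and the cocycle formulas for
products and inverses preserve this. -/
theorem exists_wreath (g : GSGroup p) : ∃ (k : ZMod p) (σ : ZMod p → GSGroup p),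
    ∀ i w, act g (i :: w) = (i + k) :: act (σ i) w := by
  induction g using generators_induction with
  | hA => exact ⟨1, fun _ => 1, act_genA_cons⟩
  | hB => exact ⟨0, secB, fun i w => by rw [act_genB_cons, add_zero]⟩
  | h1 => exact ⟨0, fun _ => 1, fun i w => by simp⟩
  | hmul x y hx hy =>
    obtain ⟨k, σ, h⟩ := hx
    obtain ⟨l, τ, h'⟩ := hy
    exact ⟨l + k, fun i => σ (i + l) * τ i, fun i w => by rw [act_mul, h', h, act_mul, add_assoc]⟩
  | hinv x hx =>
    obtain ⟨k, σ, h⟩ := hx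
    refine ⟨-k, fun i => (σ (i - k))⁻¹, fun i w => ?_⟩
    have : act x ((i + -k) :: act (σ (i - k))⁻¹ w) = i :: w := by
      rw [h, ← sub_eq_add_neg, act_act_inv, sub_add_cancel]
    rw [← this, act_inv_act]

/-- The rotation that a group element induces on the first letters. -/
noncomputable def rot (g : GSGroup p) : ZMod p := (exists_wreath g).choose

/-- The section of a group element at a letter. -/
noncomputable def sec (g : GSGroup p) : ZMod p → GSGroup p :=
  (exists_wreath g).choose_spec.choose

theorem act_cons (g : GSGroup p) (i w) : act g (i :: w) = (i + rot g) :: act (sec g i) w :=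
  (exists_wreath g).choose_spec.choose_spec i w

theorem wreath_unique {g : GSGroup p} {k : ZMod p} {σ : ZMod p → GSGroup p}
    (h : ∀ i w, act g (i :: w) = (i + k) :: act (σ i) w) : rot g = k ∧ ∀ i, sec g i = σ i := by
  refine ⟨?_, fun i => act_ext fun w => ?_⟩
  · have := (act_cons g 0 []).symm.trans (h 0 [])
    simpa using (List.cons.inj this).1
  · exact (List.cons.inj ((act_cons g i w).symm.trans (h i w))).2

@[simp] theorem rot_genA : rot (genA p) = 1 :=
  (wreath_unique (σ := fun _ => 1) act_genA_cons).1

@[simp] theorem sec_genA (i : ZMod p) : sec (genA p) i = 1 :=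
  (wreath_unique (σ := fun _ => 1) act_genA_cons).2 i

@[simp] theorem rot_genB : rot (genB p) = 0 :=
  (wreath_unique (k := 0) fun i w => by rw [act_genB_cons, add_zero]).1

@[simp] theorem sec_genB (i : ZMod p) : sec (genB p) i = secB i :=
  (wreath_unique (k := 0) fun i w => by rw [act_genB_cons, add_zero]).2 i

@[simp] theorem rot_one : rot (1 : GSGroup p) = 0 :=
  (wreath_unique (k := 0) (σ := fun _ => 1) fun i w => by simp).1

@[simp] theorem sec_one (i : ZMod p) : sec (1 : GSGroup p) i = 1 :=
  (wreath_unique (k := 0) (σ := fun _ => 1) fun i w => by simp).2 i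

theorem wreath_mul (g h : GSGroup p) :
    rot (g * h) = rot h + rot g ∧ ∀ i, sec (g * h) i = sec g (i + rot h) * sec h i :=
  wreath_unique fun i w => by rw [act_mul, act_cons, act_cons, act_mul, add_assoc]

@[simp] theorem rot_mul (g h : GSGroup p) : rot (g * h) = rot g + rot h := by
  rw [(wreath_mul g h).1, add_comm]

@[simp] theorem sec_mul (g h : GSGroup p) (i) : sec (g * h) i = sec g (i + rot h) * sec h i :=
  (wreath_mul g h).2 i

@[simp] theorem rot_inv (g : GSGroup p) : rot g⁻¹ = -rot g := by
  have h : rot (g * g⁻¹) = 0 := by rw [mul_inv_cancel, rot_one]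
  rw [rot_mul] at h
  exact (neg_eq_of_add_eq_zero_right h).symm

@[simp] theorem sec_inv (g : GSGroup p) (i) : sec g⁻¹ i = (sec g (i - rot g))⁻¹ := by
  have h : sec (g * g⁻¹) i = 1 := by rw [mul_inv_cancel, sec_one]
  rw [sec_mul, rot_inv, ← sub_eq_add_neg] at h
  exact (inv_eq_of_mul_eq_one_right h).symm

theorem wreath_ext {g h : GSGroup p} (hr : rot g = rot h) (hs : ∀ i, sec g i = sec h i) :
    g = h := by
  refine act_ext fun w => ?_
  cases w with
  | nil => rw [act_nil, act_nil]
  | cons i w => rw [act_cons, act_cons, hr, hs]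

theorem wreath_eq_one {g : GSGroup p} (hr : rot g = 0) (hs : ∀ i, sec g i = 1) : g = 1 :=
  wreath_ext (by simp [hr]) (by simp [hs])

@[simp] theorem rot_zpow (g : GSGroup p) (n : ℤ) : rot (g ^ n) = n * rot g := by
  induction n using Int.induction_on with
  | zero => simp
  | succ n ih => rw [zpow_add_one, rot_mul, ih]; push_cast; ring
  | pred n ih => rw [zpow_sub_one, rot_mul, ih, rot_inv]; push_cast; ring

@[simp] theorem rot_pow (g : GSGroup p) (n : ℕ) : rot (g ^ n) = n * rot g := by
  exact_mod_cast rot_zpow g n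

theorem sec_zpow {g : GSGroup p} (hg : rot g = 0) (n : ℤ) (i) : sec (g ^ n) i = sec g i ^ n := by
  induction n using Int.induction_on with
  | zero => simp
  | succ n ih => rw [zpow_add_one, sec_mul, hg, add_zero, ih, zpow_add_one]
  | pred n ih => rw [zpow_sub_one, sec_mul, rot_inv, hg, neg_zero, add_zero, ih, zpow_sub_one,
      sec_inv, hg, sub_zero]

@[simp] theorem sec_genA_zpow (n : ℤ) (i : ZMod p) : sec (genA p ^ n) i = 1 := by
  induction n using Int.induction_on generalizing i with
  | zero => simp
  | succ n ih => rw [zpow_add_one, sec_mul, sec_genA, mul_one, ih]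
  | pred n ih => rw [zpow_sub_one, sec_mul, ih, sec_inv, sec_genA]; simp

theorem genA_pow : genA p ^ p = 1 := by
  refine wreath_eq_one (by simp) fun i => ?_
  simpa using sec_genA_zpow (p : ℤ) i

/-! ### Level stabilizers -/

/-- The stabilizer of the first level. -/
def firstStab (p : ℕ) : Subgroup (GSGroup p) where
  carrier := {g | rot g = 0}
  one_mem' := rot_one
  mul_mem' := by
    intro x y (hx : rot x = 0) (hy : rot y = 0)
    change rot (x * y) = 0
    simp [hx, hy]
  inv_mem' := by
    intro x (hx : rot x = 0)
    change rot x⁻¹ = 0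
    simp [hx]

@[simp] theorem mem_firstStab {g : GSGroup p} : g ∈ firstStab p ↔ rot g = 0 := Iff.rfl

/-- The rotation as a homomorphism. -/
noncomputable def rotHom (p : ℕ) : GSGroup p →* Multiplicative (ZMod p) where
  toFun g := Multiplicative.ofAdd (rot g)
  map_one' := by simp
  map_mul' g h := by simp

theorem ker_rotHom : (rotHom p).ker = firstStab p := by
  ext g; simp [MonoidHom.mem_ker, rotHom]

/-- The section at a letter as a homomorphism from the stabilizer of the first level. -/
noncomputable def secHom (i : ZMod p) : firstStab p →* GSGroup p where
  toFun g := sec g i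
  map_one' := by simp
  map_mul' g h := by
    have : rot (h : GSGroup p) = 0 := h.2
    simp [this]

theorem eq_one_of_secHom {g : firstStab p} (h : ∀ i, secHom i g = 1) : g = 1 :=
  Subtype.ext (wreath_eq_one g.2 h)

/-- The stabilizers of the levels of the tree. -/
def LevelStab : ℕ → GSGroup p → Prop
  | 0, _ => True
  | n + 1, g => rot g = 0 ∧ ∀ i, LevelStab n (sec g i)

theorem eq_one_of_levelStab {g : GSGroup p} (h : ∀ n, LevelStab n g) : g = 1 := by
  refine act_ext fun w => ?_
  rw [act_one]
  induction w generalizing g with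
  | nil => exact act_nil g
  | cons i w ih =>
    rw [act_cons, (h 1).1, add_zero, ih fun n => (h (n + 1)).2 i]

theorem exists_finiteIndex_le_levelStab [NeZero p] (n : ℕ) :
    ∃ F : Subgroup (GSGroup p), F.FiniteIndex ∧ ∀ g ∈ F, LevelStab n g := by
  induction n with
  | zero => exact ⟨⊤, inferInstance, fun _ _ => trivial⟩
  | succ n ih =>
    obtain ⟨F, hF, h⟩ := ih
    have h1 : (firstStab p).FiniteIndex := by rw [← ker_rotHom]; infer_instance
    refine ⟨(⨅ i, F.comap (secHom i)).map (firstStab p).subtype, ?_, ?_⟩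
    · constructor
      rw [Subgroup.index_map_subtype]
      exact mul_ne_zero (Subgroup.finiteIndex_iInf fun i => Subgroup.finiteIndex_comap hF _).1 h1.1
    · rintro _ ⟨g, hg, rfl⟩
      exact ⟨g.2, fun i => h _ ((Subgroup.mem_iInf.1 hg) i)⟩

instance [NeZero p] : (firstStab p).FiniteIndex := by rw [← ker_rotHom]; infer_instance

theorem proClosed_bot [NeZero p] : (⊥ : Subgroup (GSGroup p)).ProClosed := by
  intro x hx
  have : ∃ n, ¬ LevelStab n x := by
    by_contra! h
    exact hx (Subgroup.mem_bot.2 (eq_one_of_levelStab h))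
  obtain ⟨n, hn⟩ := this
  obtain ⟨F, hF, h⟩ := exists_finiteIndex_le_levelStab (p := p) n
  exact ⟨F, hF, bot_le, fun hxF => hn (h x hxF)⟩

end GuptaSidki

namespace GuptaSidki

variable {p : ℕ}

/-! ### The exponent of `b` -/

section Exponent

variable [Fact p.Prime]

theorem sum_shift {M : Type*} [AddCommMonoid M] (f : ZMod p → M) (c : ZMod p) :
    ∑ i, f (i + c) = ∑ i, f i :=
  Equiv.sum_comp (Equiv.addRight c) f

theorem rot_secB (i : ZMod p) :
    rot (secB i) = (if i = 0 then 1 else 0) - (if i = 1 then 1 else 0) := by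
  have h10 : (1 : ZMod p) ≠ 0 := one_ne_zero
  unfold secB
  split_ifs <;> simp_all

theorem sum_rot_sec (g : GSGroup p) : ∑ i, rot (sec g i) = 0 := by
  induction g using generators_induction with
  | hA => simp
  | hB => simp [rot_secB]
  | h1 => simp
  | hmul x y hx hy =>
    simp only [sec_mul, rot_mul, Finset.sum_add_distrib]
    rw [sum_shift (fun i => rot (sec x i)), hx, hy, add_zero]
  | hinv x hx =>
    simp only [sec_inv, rot_inv, Finset.sum_neg_distrib, sub_eq_add_neg]
    rw [sum_shift (fun i => rot (sec x i)), hx, neg_zero]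

/-- The total exponent of `b` in a group element. -/
noncomputable def bexp (g : GSGroup p) : ZMod p := -∑ i, i * rot (sec g i)

@[simp] theorem bexp_mul (g h : GSGroup p) : bexp (g * h) = bexp g + bexp h := by
  unfold bexp
  simp only [sec_mul, rot_mul, mul_add, Finset.sum_add_distrib]
  have : ∑ i, i * rot (sec g (i + rot h)) = ∑ i, i * rot (sec g i) := by
    have h1 := sum_shift (fun i => (i - rot h) * rot (sec g i)) (rot h)
    simp only [add_sub_cancel_right] at h1
    rw [h1]
    simp only [sub_mul, Finset.sum_sub_distrib, ← Finset.mul_sum, sum_rot_sec, mul_zero, sub_zero]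
  rw [this, neg_add]

@[simp] theorem bexp_one : bexp (1 : GSGroup p) = 0 := by simp [bexp]

@[simp] theorem bexp_inv (g : GSGroup p) : bexp g⁻¹ = -bexp g := by
  have h : bexp (g * g⁻¹) = 0 := by rw [mul_inv_cancel, bexp_one]
  rw [bexp_mul] at h
  exact (neg_eq_of_add_eq_zero_right h).symm

@[simp] theorem bexp_genA : bexp (genA p) = 0 := by simp [bexp]

@[simp] theorem bexp_genB : bexp (genB p) = 1 := by
  simp [bexp, rot_secB, mul_sub]

@[simp] theorem bexp_zpow (g : GSGroup p) (n : ℤ) : bexp (g ^ n) = n * bexp g := by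
  induction n using Int.induction_on with
  | zero => simp
  | succ n ih => rw [zpow_add_one, bexp_mul, ih]; push_cast; ring
  | pred n ih => rw [zpow_sub_one, bexp_mul, ih, bexp_inv]; push_cast; ring

end Exponent

section Odd

variable [Fact p.Prime] [hp2 : Fact (2 < p)]

theorem two_ne_zero' : (2 : ZMod p) ≠ 0 := by
  intro h
  have : ((2 : ℕ) : ZMod p) = 0 := by exact_mod_cast h
  rw [ZMod.natCast_eq_zero_iff] at this
  exact absurd (Nat.le_of_dvd two_pos this) (not_le.2 hp2.out)

theorem one_ne_neg_one : (1 : ZMod p) ≠ -1 := by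
  intro h
  apply two_ne_zero' (p := p)
  linear_combination h

@[simp] theorem secB_zero : secB (0 : ZMod p) = genA p := by simp [secB]

@[simp] theorem secB_one : secB (1 : ZMod p) = (genA p)⁻¹ := by simp [secB]

@[simp] theorem secB_neg_one : secB (-1 : ZMod p) = genB p := by
  simp [secB, one_ne_neg_one.symm]

theorem secB_of_ne {i : ZMod p} (h0 : i ≠ 0) (h1 : i ≠ 1) (h2 : i ≠ -1) : secB i = 1 := by
  simp [secB, h0, h1, h2]

theorem bexp_secB (i : ZMod p) : bexp (secB i) = if i = -1 then 1 else 0 := by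
  by_cases h2 : i = -1
  · simp [h2]
  by_cases h0 : i = 0
  · simp [h0]
  by_cases h1 : i = 1
  · simp [h1, one_ne_neg_one]
  simp [secB_of_ne h0 h1 h2, h2]

/-- A conjugate of `b` by a power of `a` that has `b` at a letter has `a` at the next letter and
`a⁻¹` at the one after. -/
theorem rot_sec (g : GSGroup p) (i : ZMod p) :
    rot (sec g i) = bexp (sec g (i - 1)) - bexp (sec g (i - 2)) := by
  induction g using generators_induction generalizing i with
  | hA => simp
  | hB =>
    simp only [sec_genB, rot_secB, bexp_secB]
    congr 2
    · simp
    · rw [sub_eq_iff_eq_add]; norm_num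
  | h1 => simp
  | hmul x y hx hy =>
    rw [sec_mul, rot_mul, hx, hy, sec_mul, sec_mul, bexp_mul, bexp_mul,
      show i - 1 + rot y = i + rot y - 1 by ring, show i - 2 + rot y = i + rot y - 2 by ring]
    ring
  | hinv x hx =>
    rw [sec_inv, rot_inv, hx, sec_inv, sec_inv, bexp_inv, bexp_inv,
      show i - 1 - rot x = i - rot x - 1 by ring, show i - 2 - rot x = i - rot x - 2 by ring]
    ring

theorem sum_bexp_sec (g : GSGroup p) : ∑ i, bexp (sec g i) = bexp g := by
  conv_rhs => unfold bexp
  simp only [rot_sec, mul_sub, Finset.sum_sub_distrib]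
  have h1 := sum_shift (fun i => (i + 1) * bexp (sec g i)) (-1)
  have h2 := sum_shift (fun i => (i + 2) * bexp (sec g i)) (-2)
  simp only [← sub_eq_add_neg, sub_add_cancel] at h1 h2
  rw [h1, h2, ← Finset.sum_sub_distrib, ← Finset.sum_neg_distrib]
  refine Finset.sum_congr rfl fun i _ => ?_
  ring

/-- The sections of `b ^ p` are trivial except for `b ^ p` itself at `-1`, so it fixes every level.
-/
theorem genB_pow : genB p ^ p = 1 := by
  have h : ∀ n, LevelStab n (genB p ^ p) := by
    intro n
    induction n with
    | zero => trivial
    | succ n ih =>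
      refine ⟨by simp, fun i => ?_⟩
      have hone : LevelStab n (1 : GSGroup p) := by
        clear ih
        induction n with
        | zero => trivial
        | succ n ih => exact ⟨rot_one, fun i => by rwa [sec_one]⟩
      have := sec_zpow (rot_genB (p := p)) (p : ℤ) i
      rw [zpow_natCast, zpow_natCast, sec_genB] at this
      rw [this]
      by_cases h2 : i = -1
      · rwa [h2, secB_neg_one]
      by_cases h0 : i = 0
      · rwa [h0, secB_zero, genA_pow]
      by_cases h1 : i = 1
      · rwa [h1, secB_one, inv_pow, genA_pow, inv_one]
      rwa [secB_of_ne h0 h1 h2, one_pow]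
  exact eq_one_of_levelStab h

theorem secB_pow (i : ZMod p) : secB i ^ p = 1 := by
  by_cases h2 : i = -1
  · rw [h2, secB_neg_one, genB_pow]
  by_cases h0 : i = 0
  · rw [h0, secB_zero, genA_pow]
  by_cases h1 : i = 1
  · rw [h1, secB_one, inv_pow, genA_pow, inv_one]
  rw [secB_of_ne h0 h1 h2, one_pow]

end Odd

theorem zpow_eq_one_of_cast {H : Type*} [Group H] {x : H} (hx : x ^ p = 1) {k : ℤ}
    (hk : (k : ZMod p) = 0) : x ^ k = 1 := by
  obtain ⟨m, rfl⟩ := (ZMod.intCast_zmod_eq_zero_iff_dvd k p).1 hk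
  rw [zpow_mul, zpow_natCast, hx, one_zpow]

/-! ### Length -/

/-- `Len n g` says that `g` is a product of powers of `a` and at most `n` powers of `b`. -/
inductive Len : ℕ → GSGroup p → Prop
  | base (k : ℤ) : Len 0 (genA p ^ k)
  | step {n : ℕ} {g : GSGroup p} (e k : ℤ) : Len n g → Len (n + 1) (g * genB p ^ e * genA p ^ k)

namespace Len

theorem one : Len 0 (1 : GSGroup p) := by simpa using base (p := p) 0

theorem succ {n : ℕ} {g : GSGroup p} (h : Len n g) : Len (n + 1) g := by
  simpa using step 0 0 h

theorem mono {n m : ℕ} {g : GSGroup p} (h : Len n g) (hnm : n ≤ m) : Len m g := by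
  induction hnm with
  | refl => exact h
  | step _ ih => exact ih.succ

theorem mul_genA {n : ℕ} {g : GSGroup p} (h : Len n g) (k : ℤ) : Len n (g * genA p ^ k) := by
  cases h with
  | base l => rw [← zpow_add]; exact base _
  | step e l h => rw [mul_assoc, ← zpow_add]; exact step _ _ h

theorem genA_mul {n : ℕ} {g : GSGroup p} (h : Len n g) (k : ℤ) : Len n (genA p ^ k * g) := by
  induction h with
  | base l => rw [← zpow_add]; exact base _
  | step e l _ ih => rw [← mul_assoc, ← mul_assoc]; exact step _ _ ih

theorem mul {m n : ℕ} {g h : GSGroup p} (hg : Len m g) (hh : Len n h) : Len (m + n) (g * h) := by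
  induction hh with
  | base l => exact hg.mul_genA l
  | step e l _ ih => rw [← mul_assoc, ← mul_assoc]; exact step _ _ ih

theorem genB_zpow (e : ℤ) : Len 1 (genB p ^ e) := by simpa using step e 0 (one (p := p))

theorem inv {n : ℕ} {g : GSGroup p} (h : Len n g) : Len n g⁻¹ := by
  induction h with
  | base l => rw [← zpow_neg]; exact base _
  | @step n g e l _ ih =>
    rw [mul_inv_rev, mul_inv_rev, ← zpow_neg, ← zpow_neg, add_comm]
    exact (((genB_zpow _).mul ih).genA_mul _)

theorem exists_len (g : GSGroup p) : ∃ n, Len n g := by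
  induction g using generators_induction with
  | hA => exact ⟨0, by simpa using base (p := p) 1⟩
  | hB => exact ⟨1, by simpa using genB_zpow (p := p) 1⟩
  | h1 => exact ⟨0, one⟩
  | hmul x y hx hy =>
    obtain ⟨m, hm⟩ := hx
    obtain ⟨n, hn⟩ := hy
    exact ⟨m + n, hm.mul hn⟩
  | hinv x hx =>
    obtain ⟨m, hm⟩ := hx
    exact ⟨m, hm.inv⟩

end Len

theorem sec_step (g : GSGroup p) (e k : ℤ) (i : ZMod p) :
    sec (g * genB p ^ e * genA p ^ k) i = sec g (i + (k : ZMod p)) * secB (i + (k : ZMod p)) ^ e := by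
  simp [sec_zpow]

/-! ### Lengths of sections -/

section OddLen

variable [Fact p.Prime] [hp2 : Fact (2 < p)]

theorem len_secB_zpow (i : ZMod p) (e : ℤ) : Len (if i = -1 then 1 else 0) (secB i ^ e) := by
  by_cases h2 : i = -1
  · simpa [h2] using Len.genB_zpow (p := p) e
  rw [if_neg h2]
  by_cases h0 : i = 0
  · rw [h0, secB_zero]; exact Len.base e
  by_cases h1 : i = 1
  · rw [h1, secB_one, inv_zpow, ← zpow_neg]; exact Len.base _
  rw [secB_of_ne h0 h1 h2, one_zpow]; exact Len.one

/-- A power of `b` contributes a power of `b` to the section at one letter only, so the syllables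
are distributed among the sections. -/
theorem Len.exists_sum {n : ℕ} {g : GSGroup p} (h : Len n g) :
    ∃ ν : ZMod p → ℕ, (∀ i, Len (ν i) (sec g i)) ∧ ∑ i, ν i ≤ n := by
  induction h with
  | base k => exact ⟨fun _ => 0, fun i => by rw [sec_genA_zpow]; exact Len.one, by simp⟩
  | @step n g e k _ ih =>
    obtain ⟨ν, h1, h2⟩ := ih
    refine ⟨fun i => ν (i + (k : ZMod p)) + if i + (k : ZMod p) = -1 then 1 else 0, fun i => ?_, ?_⟩
    · rw [sec_step]
      exact (h1 _).mul (len_secB_zpow _ e)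
    · rw [sum_shift (fun i => ν i + if i = -1 then 1 else 0), Finset.sum_add_distrib]
      simpa using h2

/-- Two consecutive powers of `b` separated by a nontrivial power of `a` contribute to sections at
different letters, so each section receives at most one of the two. -/
theorem Len.half {n : ℕ} {g : GSGroup p} (h : Len n g) (i : ZMod p) :
    Len ((n + 1) / 2) (sec g i) := by
  induction n using Nat.strong_induction_on generalizing g i with
  | _ n ih =>
    cases h with
    | base k => rw [sec_genA_zpow]; exact Len.one
    | @step n g f l h =>
      cases h with
      | base k =>
        rw [sec_step, sec_genA_zpow, one_mul]
        refine (len_secB_zpow _ f).mono ?_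
        split_ifs <;> simp
      | @step n g e k h =>
        -- A trivial power of `a` between the last two syllables lets them merge.
        by_cases hk : (k : ZMod p) = 0
        · rw [zpow_eq_one_of_cast genA_pow hk, mul_one, mul_assoc g, ← zpow_add]
          exact (ih (n + 1) (Nat.lt_succ_self _) (h.step (e + f) l) i).mono (by omega)
        · rw [sec_step, sec_step]
          have h1 := ((ih n (by omega) h (i + (l : ZMod p) + (k : ZMod p))).mul
            (len_secB_zpow (i + (l : ZMod p) + (k : ZMod p)) e)).mul
            (len_secB_zpow (i + (l : ZMod p)) f)
          refine h1.mono ?_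
          have : ¬ (i + (l : ZMod p) + (k : ZMod p) = -1 ∧ i + (l : ZMod p) = -1) := by
            rintro ⟨h1, h2⟩
            rw [h2] at h1
            exact hk (by simpa using h1)
          split_ifs <;> first | omega | (exfalso; tauto)

theorem sum_range_orbit {M : Type*} [AddCommMonoid M] (f : ZMod p → M) (i : ZMod p) {r : ZMod p}
    (hr : r ≠ 0) : ∑ k ∈ Finset.range p, f (i + k * r) = ∑ j, f j := by
  refine Finset.sum_nbij' (fun k => i + k * r) (fun j => ((j - i) / r).val) ?_ ?_ ?_ ?_ ?_
  · intro k _; exact Finset.mem_univ _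
  · intro j _; exact Finset.mem_range.2 (ZMod.val_lt _)
  · intro k hk
    have : (i + (k : ZMod p) * r - i) / r = k := by field_simp; ring
    simp only [this]
    exact ZMod.val_cast_of_lt (Finset.mem_range.1 hk)
  · intro j _
    simp only [ZMod.natCast_val, ZMod.cast_id', id_eq]
    field_simp
    ring
  · intro k _; rfl

theorem sec_pow_sum {φ : GSGroup p → ZMod p} (h1 : φ 1 = 0) (hmul : ∀ x y, φ (x * y) = φ x + φ y)
    (g : GSGroup p) (m : ℕ) (i : ZMod p) :
    φ (sec (g ^ m) i) = ∑ k ∈ Finset.range m, φ (sec g (i + k * rot g)) := by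
  induction m generalizing i with
  | zero => simp [h1]
  | succ m ih =>
    rw [pow_succ, sec_mul, hmul, ih, Finset.sum_range_succ']
    congr 1
    · refine Finset.sum_congr rfl fun k _ => ?_
      congr 2
      push_cast; ring
    · simp

theorem len_sec_pow {g : GSGroup p} {ν : ZMod p → ℕ} (h : ∀ i, Len (ν i) (sec g i)) (m : ℕ)
    (i : ZMod p) : Len (∑ k ∈ Finset.range m, ν (i + k * rot g)) (sec (g ^ m) i) := by
  induction m generalizing i with
  | zero => simpa using Len.one
  | succ m ih =>
    rw [pow_succ, sec_mul, Finset.sum_range_succ']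
    refine Len.mul ?_ (by simpa using h i)
    have : ∀ k : ℕ, i + ((k + 1 : ℕ) : ZMod p) * rot g = i + rot g + k * rot g := fun k => by
      push_cast
      ring
    simp only [this]
    exact ih _

/-- The sections of the `p`-th power of an element that does not fix the first level. -/
theorem sec_pow_p {n : ℕ} {g : GSGroup p} (hn : Len n g) (hg : rot g ≠ 0) (i : ZMod p) :
    Len n (sec (g ^ p) i) ∧ rot (sec (g ^ p) i) = 0 ∧ bexp (sec (g ^ p) i) = bexp g := by
  obtain ⟨ν, h1, h2⟩ := hn.exists_sum
  refine ⟨?_, ?_, ?_⟩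
  · refine (len_sec_pow h1 p i).mono ?_
    rwa [sum_range_orbit ν i hg]
  · rw [sec_pow_sum rot_one rot_mul, sum_range_orbit (fun j => rot (sec g j)) i hg, sum_rot_sec]
  · rw [sec_pow_sum bexp_one bexp_mul, sum_range_orbit (fun j => bexp (sec g j)) i hg, sum_bexp_sec]

/-! ### Torsion -/

theorem exists_pow_eq_one_of_sec {g : GSGroup p} (hg : rot g = 0)
    (h : ∀ i, ∃ k : ℕ, sec g i ^ p ^ k = 1) : ∃ k : ℕ, g ^ p ^ k = 1 := by
  choose k hk using h
  refine ⟨∑ i, k i, wreath_eq_one (by simp [hg]) fun i => ?_⟩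
  have := sec_zpow hg ((p ^ ∑ i, k i : ℕ) : ℤ) i
  rw [zpow_natCast, zpow_natCast] at this
  rw [this, ← Finset.add_sum_erase _ _ (Finset.mem_univ i), pow_add, pow_mul, hk, one_pow]

/-- Induct on length. Sections of an element fixing the first level are shorter. Otherwise the
`p`-th power has sections that are no longer than the element and fix the first level, so one more
descent shortens. -/
theorem isPGroup : IsPGroup p (GSGroup p) := by
  have key : ∀ n, ∀ g : GSGroup p, Len n g → ∃ k : ℕ, g ^ p ^ k = 1 := by
    intro n
    induction n using Nat.strong_induction_on with
    | _ n ih =>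
      have h0 : ∀ g : GSGroup p, Len n g → rot g = 0 → ∃ k : ℕ, g ^ p ^ k = 1 := by
        intro g hg hr
        refine exists_pow_eq_one_of_sec hr fun i => ?_
        rcases lt_or_ge 1 n with h1 | h1
        · exact ih _ (by omega) _ (hg.half i)
        · have hg' := hg.mono h1
          cases hg' with
          | @step n' g' e k hb =>
            cases hb with
            | base l =>
              rw [sec_step, sec_genA_zpow, one_mul]
              exact ⟨1, by rw [pow_one, ← zpow_natCast, zpow_comm, zpow_natCast, secB_pow,
                one_zpow]⟩
      intro g hg
      by_cases hr : rot g = 0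
      · exact h0 g hg hr
      · have : ∃ k : ℕ, (g ^ p) ^ p ^ k = 1 := by
          refine exists_pow_eq_one_of_sec (by simp) fun i => ?_
          obtain ⟨h1, h2, _⟩ := sec_pow_p hg hr i
          exact h0 _ h1 h2
        obtain ⟨k, hk⟩ := this
        exact ⟨k + 1, by rw [pow_succ', pow_mul, hk]⟩
  intro g
  obtain ⟨n, hn⟩ := Len.exists_len g
  exact key n g hn

end OddLen

end GuptaSidki

theorem finiteIndex_commutator_of_torsion {H : Type*} [Group H] [Group.FG H]
    (h : ∀ x : H, IsOfFinOrder x) : (commutator H).FiniteIndex := by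
  have : Group.FG (Abelianization H) := Group.fg_of_surjective (f := Abelianization.of)
    (QuotientGroup.mk'_surjective _)
  have ht : IsMulTorsion (Abelianization H) := by
    exact fun x => by
      obtain ⟨y, rfl⟩ := QuotientGroup.mk'_surjective _ x
      exact MonoidHom.isOfFinOrder _ (h y)
  have : Finite (H ⧸ commutator H) :=
    CommGroup.finite_of_fg_isMulTorsion (Abelianization H) ht
  exact Subgroup.finiteIndex_of_finite_quotient

open scoped commutatorElement

namespace GuptaSidki

variable {p : ℕ}

section

variable [Fact p.Prime] [hp2 : Fact (2 < p)]

/-! ### Sections of subgroups -/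

/-- The sections at the letter `i` of the elements of `M` that fix the first level. -/
noncomputable def secSub (M : Subgroup (GSGroup p)) (i : ZMod p) : Subgroup (GSGroup p) :=
  (M.subgroupOf (firstStab p)).map (secHom i)

theorem mem_secSub {M : Subgroup (GSGroup p)} {i : ZMod p} {x : GSGroup p} :
    x ∈ secSub M i ↔ ∃ g ∈ M, rot g = 0 ∧ sec g i = x := by
  constructor
  · rintro ⟨g, hg, rfl⟩
    exact ⟨g, hg, g.2, rfl⟩
  · rintro ⟨g, hg, hr, rfl⟩
    exact ⟨⟨g, hr⟩, hg, rfl⟩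

/-- The conjugates `aᵏ b a⁻ᵏ`. -/
noncomputable def conjB (k : ZMod p) : GSGroup p :=
  genA p ^ (k.val : ℤ) * genB p * genA p ^ (-(k.val : ℤ))

@[simp] theorem rot_conjB (k : ZMod p) : rot (conjB k) = 0 := by
  simp [conjB]

@[simp] theorem sec_conjB (k i : ZMod p) : sec (conjB k) i = secB (i - k) := by
  unfold conjB
  rw [sec_mul, sec_mul, sec_genA_zpow, sec_genA_zpow, one_mul, mul_one, rot_zpow, rot_genA]
  simp [sub_eq_add_neg]

theorem secSub_top (i : ZMod p) : secSub (⊤ : Subgroup (GSGroup p)) i = ⊤ := by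
  refine eq_top_of_generators ?_ ?_
  · exact mem_secSub.2 ⟨conjB i, trivial, rot_conjB i, by simp⟩
  · exact mem_secSub.2 ⟨conjB (i + 1), trivial, rot_conjB _, by simp⟩

theorem exists_sec_eq (i : ZMod p) (x : GSGroup p) : ∃ g, rot g = 0 ∧ sec g i = x := by
  have h : x ∈ secSub (⊤ : Subgroup (GSGroup p)) i := by rw [secSub_top]; trivial
  obtain ⟨g, _, h1, h2⟩ := mem_secSub.1 h
  exact ⟨g, h1, h2⟩

theorem secHom_surjective (i : ZMod p) : Function.Surjective (secHom (p := p) i) := fun x => by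
  obtain ⟨g, h1, h2⟩ := exists_sec_eq i x
  exact ⟨⟨g, h1⟩, h2⟩

theorem sec_commutatorElement {x y : GSGroup p} (hx : rot x = 0) (hy : rot y = 0) (i : ZMod p) :
    sec ⁅x, y⁆ i = ⁅sec x i, sec y i⁆ := by
  simp [commutatorElement_def, hx, hy]

theorem rot_commutatorElement (x y : GSGroup p) : rot ⁅x, y⁆ = 0 := by
  simp [commutatorElement_def]

/-- `y` is the element acting as `x` below `i` and trivially elsewhere. -/
def IsAt (i : ZMod p) (x y : GSGroup p) : Prop :=
  rot y = 0 ∧ sec y i = x ∧ ∀ j, j ≠ i → sec y j = 1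

/-- The elements that, acting below the letter `i` only, belong to `N`. -/
def ristSub (N : Subgroup (GSGroup p)) (i : ZMod p) : Subgroup (GSGroup p) where
  carrier := {x | ∃ y ∈ N, IsAt i x y}
  one_mem' := ⟨1, N.one_mem, by simp [IsAt]⟩
  mul_mem' := by
    rintro x x' ⟨y, hy, h1, h2, h3⟩ ⟨y', hy', h1', h2', h3'⟩
    refine ⟨y * y', N.mul_mem hy hy', by simp [h1, h1'], by simp [h1', h2, h2'], fun j hj => ?_⟩
    simp [h1', h3 j hj, h3' j hj]
  inv_mem' := by
    rintro x ⟨y, hy, h1, h2, h3⟩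
    refine ⟨y⁻¹, N.inv_mem hy, by simp [h1], by simp [h1, h2], fun j hj => ?_⟩
    simp [h1, h3 j hj]

theorem IsAt.conj {i : ZMod p} {x y : GSGroup p} (h : IsAt i x y) (g : GSGroup p) :
    IsAt (i + rot g) (sec g i * x * (sec g i)⁻¹) (g * y * g⁻¹) := by
  obtain ⟨h1, h2, h3⟩ := h
  refine ⟨by simp [h1], ?_, fun j hj => ?_⟩
  · simp [h1, h2]
  · have : j - rot g ≠ i := fun h => hj (by rw [← h]; ring)
    have h4 := h3 (j - rot g) this
    simp [h1, h4, ← sub_eq_add_neg]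

/-- Every group element is the section at `i` of an element fixing the first level, so conjugation
can be lifted. -/
theorem ristSub_normal {N : Subgroup (GSGroup p)} (hN : N.Normal) (i : ZMod p) :
    (ristSub N i).Normal := by
  constructor
  rintro x ⟨y, hy, hxy⟩ g
  obtain ⟨Y, h1, rfl⟩ := exists_sec_eq i g
  refine ⟨Y * y * Y⁻¹, hN.conj_mem _ hy _, ?_⟩
  simpa [h1] using hxy.conj Y

theorem ristSub_le {N : Subgroup (GSGroup p)} (hN : N.Normal) (i j : ZMod p) :
    ristSub N i ≤ ristSub N j := by
  rintro x ⟨y, hy, hxy⟩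
  refine ⟨_, hN.conj_mem _ hy (genA p ^ ((j - i).val : ℤ)), ?_⟩
  simpa using hxy.conj (genA p ^ ((j - i).val : ℤ))

/-- Conjugating by powers of `a` gives the same at every letter. Peeling off one letter at a time
shows that `N` contains the product of the groups `ristSub N j`. -/
theorem finiteIndex_of_ristSub {N : Subgroup (GSGroup p)} (hN : N.Normal) {i : ZMod p}
    (h : (ristSub N i).FiniteIndex) : N.FiniteIndex := by
  classical
  have hj : ∀ j, (ristSub N j).FiniteIndex := fun j =>
    Subgroup.finiteIndex_of_le (ristSub_le hN i j)
  have key : ∀ s : Finset (ZMod p), ∀ g : GSGroup p, rot g = 0 → (∀ j, sec g j ∈ ristSub N j) →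
      (∀ j ∉ s, sec g j = 1) → g ∈ N := by
    intro s
    induction s using Finset.induction_on with
    | empty =>
      intro g hg _ h
      rw [wreath_eq_one hg fun j => h j (Finset.notMem_empty j)]
      exact N.one_mem
    | insert i s hi ih =>
      intro g hg h1 h2
      obtain ⟨y, hy, hy1, hy2, hy3⟩ := h1 i
      have : y⁻¹ * g ∈ N := by
        refine ih _ (by simp [hg, hy1]) (fun j => ?_) fun j hj => ?_
        · by_cases hij : j = i
          · subst hij
            simp only [sec_mul, sec_inv, hg, hy1, add_zero, sub_zero, hy2, inv_mul_cancel]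
            exact Subgroup.one_mem _
          · simpa [hg, hy1, hy3 j hij] using h1 j
        · by_cases hij : j = i
          · subst hij
            simp [hg, hy1, hy2]
          · have := h2 j (by simp [hij, hj])
            simp [hg, hy1, hy3 j hij, this]
      simpa using N.mul_mem hy this
  have hF : ((⨅ j, (ristSub N j).comap (secHom j)).map (firstStab p).subtype).FiniteIndex := by
    constructor
    rw [Subgroup.index_map_subtype]
    exact mul_ne_zero
      (Subgroup.finiteIndex_iInf fun j => Subgroup.finiteIndex_comap (hj j) _).1
      (inferInstance : (firstStab p).FiniteIndex).1
  refine Subgroup.finiteIndex_of_le (H := (⨅ j, (ristSub N j).comap (secHom j)).map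
    (firstStab p).subtype) ?_
  rintro _ ⟨g, hg, rfl⟩
  exact key Finset.univ g g.2 (fun j => (Subgroup.mem_iInf.1 hg) j) (by simp)

/-! ### The commutator subgroup -/

theorem commutator_le_of_commute {N : Subgroup (GSGroup p)} [N.Normal]
    (h : Commute (QuotientGroup.mk' N (genA p)) (QuotientGroup.mk' N (genB p))) :
    commutator (GSGroup p) ≤ N := by
  set π := QuotientGroup.mk' N
  have h1 : ∀ x, Commute (π x) (π (genA p)) := fun x => by
    induction x using generators_induction with
    | hA => exact Commute.refl _
    | hB => exact h.symm
    | h1 => rw [map_one]; exact Commute.one_left _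
    | hmul x y hx hy => rw [map_mul]; exact hx.mul_left hy
    | hinv x hx => rw [map_inv]; exact hx.inv_left
  have h2 : ∀ x, Commute (π x) (π (genB p)) := fun x => by
    induction x using generators_induction with
    | hA => exact h
    | hB => exact Commute.refl _
    | h1 => rw [map_one]; exact Commute.one_left _
    | hmul x y hx hy => rw [map_mul]; exact hx.mul_left hy
    | hinv x hx => rw [map_inv]; exact hx.inv_left
  have h3 : ∀ x y, Commute (π x) (π y) := fun x y => by
    induction y using generators_induction with
    | hA => exact h1 x
    | hB => exact h2 x
    | h1 => rw [map_one]; exact Commute.one_right _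
    | hmul y z hy hz => rw [map_mul]; exact hy.mul_right hz
    | hinv y hy => rw [map_inv]; exact hy.inv_right
  rw [commutator_def, Subgroup.commutator_le]
  intro x _ y _
  have : π ⁅x, y⁆ = 1 := by
    rw [map_commutatorElement]
    exact commutatorElement_eq_one_iff_commute.2 (h3 x y)
  exact (QuotientGroup.eq_one_iff _).1 this

/-- Modulo commutators an element is `a ^ i * b ^ j`, where `i` and `j` are determined modulo `p`,
and `a ^ p = b ^ p = 1`. -/
theorem mem_commutator_of_eq_zero {g : GSGroup p} (hr : rot g = 0) (hb : bexp g = 0) :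
    g ∈ commutator (GSGroup p) := by
  have key : ∀ g : GSGroup p, ∃ i j : ℤ, Abelianization.of g =
      Abelianization.of (genA p) ^ i * Abelianization.of (genB p) ^ j ∧
      (i : ZMod p) = rot g ∧ (j : ZMod p) = bexp g := by
    intro g
    induction g using generators_induction with
    | hA => exact ⟨1, 0, by simp⟩
    | hB => exact ⟨0, 1, by simp⟩
    | h1 => exact ⟨0, 0, by simp⟩
    | hmul x y hx hy =>
      obtain ⟨i, j, h1, h2, h3⟩ := hx
      obtain ⟨i', j', h1', h2', h3'⟩ := hy
      refine ⟨i + i', j + j', ?_, by push_cast; rw [h2, h2', rot_mul],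
        by push_cast; rw [h3, h3', bexp_mul]⟩
      rw [map_mul, h1, h1', zpow_add, zpow_add]
      exact mul_mul_mul_comm _ _ _ _
    | hinv x hx =>
      obtain ⟨i, j, h1, h2, h3⟩ := hx
      refine ⟨-i, -j, ?_, by push_cast; rw [h2, rot_inv], by push_cast; rw [h3, bexp_inv]⟩
      rw [map_inv, h1, zpow_neg, zpow_neg, mul_inv]
  obtain ⟨i, j, h1, h2, h3⟩ := key g
  rw [hr] at h2
  rw [hb] at h3
  rw [← map_zpow, ← map_zpow, zpow_eq_one_of_cast genA_pow h2, zpow_eq_one_of_cast genB_pow h3,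
    map_one, one_mul] at h1
  exact (QuotientGroup.eq_one_iff _).1 h1

theorem four_ne_zero' : (4 : ZMod p) ≠ 0 := by
  have := mul_ne_zero (two_ne_zero' (p := p)) (two_ne_zero' (p := p))
  intro h
  exact this (by linear_combination h)

/-- The products `X` and `Y` of neighbouring conjugates of `b` are chosen for cancellation: `X` is
trivial at `1`, `Y` at `2`, and at any other nonzero letter one of the two is trivial. Only letter
`0` survives in `⁅X, Y⁆`. -/
theorem commutatorElement_mem_ristSub :
    ⁅genA p * genB p, genB p * secB (-2)⁆ ∈ ristSub (commutator (GSGroup p)) 0 := by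
  set X : GSGroup p := conjB 0 * conjB 1
  set Y : GSGroup p := conjB 1 * conjB 2
  have hX : rot X = 0 := by simp [X]
  have hY : rot Y = 0 := by simp [Y]
  have hXs : ∀ i, sec X i = secB i * secB (i - 1) := fun i => by simp [X]
  have hYs : ∀ i, sec Y i = secB (i - 1) * secB (i - 2) := fun i => by simp [Y]
  refine ⟨⁅X, Y⁆, Subgroup.commutator_mem_commutator trivial trivial,
    rot_commutatorElement X Y, ?_, fun i hi => ?_⟩
  · rw [sec_commutatorElement hX hY, hXs, hYs]
    simp
  · rw [sec_commutatorElement hX hY, hXs, hYs]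
    by_cases h1 : i = 1
    · subst h1; simp
    by_cases h2 : i = 2
    · subst h2
      rw [show (2 : ZMod p) - 1 = 1 by norm_num, sub_self]
      simp
    have h10 : i - 1 ≠ 0 := sub_ne_zero.2 h1
    have h11 : i - 1 ≠ 1 := fun h => h2 (by linear_combination h)
    have h1m : i - 1 ≠ -1 := fun h => hi (by linear_combination h)
    rw [secB_of_ne h10 h11 h1m, mul_one, one_mul]
    by_cases hm : i = -1
    · have h20 : i - 2 ≠ 0 := sub_ne_zero.2 h2
      have h21 : i - 2 ≠ 1 := by
        rw [hm]
        intro h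
        exact four_ne_zero' (p := p) (by linear_combination -h)
      have h2m : i - 2 ≠ -1 := fun h => h1 (by linear_combination h)
      rw [secB_of_ne h20 h21 h2m]
      simp
    · rw [secB_of_ne hi h1 hm]
      simp

/-- This is the branching property. By normality it is enough that `a` and `b` commute modulo
`ristSub`, and `commutatorElement_mem_ristSub` supplies a relation implying that. -/
theorem commutator_le_ristSub (i : ZMod p) :
    commutator (GSGroup p) ≤ ristSub (commutator (GSGroup p)) i := by
  have hn : (commutator (GSGroup p)).Normal := inferInstance
  refine le_trans ?_ (ristSub_le hn 0 i)
  have := ristSub_normal hn 0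
  refine commutator_le_of_commute ?_
  have h := commutatorElement_mem_ristSub (p := p)
  rw [← QuotientGroup.eq_one_iff, ← QuotientGroup.mk'_apply, map_commutatorElement,
    commutatorElement_eq_one_iff_commute, map_mul, map_mul] at h
  set π := QuotientGroup.mk' (ristSub (commutator (GSGroup p)) 0)
  have hBp : π (genB p) ^ p = 1 := by rw [← map_pow, genB_pow, map_one]
  -- For `p = 3` the letter `-2` is `1`: `a b` commutes with `b a⁻¹`, hence with `b a⁻¹ a b = b²`,
  -- and `b = (b²)²`.
  by_cases h3 : (3 : ZMod p) = 0
  · have : (-2 : ZMod p) = 1 := by linear_combination -h3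
    rw [this, secB_one, map_inv] at h
    have h4 : Commute (π (genA p) * π (genB p)) (π (genB p) ^ 2) := by
      have := h.mul_right (Commute.refl _)
      rwa [mul_assoc, inv_mul_cancel_left, ← pow_two] at this
    have h5 : Commute (π (genA p) * π (genB p)) (π (genB p)) := by
      have hp3 : p ∣ 3 := (ZMod.natCast_eq_zero_iff 3 p).1 (by exact_mod_cast h3)
      obtain ⟨m, hm⟩ := hp3
      have h6 : π (genB p) = (π (genB p) ^ 2) ^ 2 := by
        rw [← pow_mul, show 2 * 2 = 3 + 1 from rfl, pow_succ, hm, pow_mul, hBp, one_pow, one_mul]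
      have h7 := h4.pow_right 2
      rwa [← h6] at h7
    have := h5.mul_left (Commute.refl (π (genB p))).inv_left
    simpa using this
  · have h20 : (-2 : ZMod p) ≠ 0 := neg_ne_zero.2 two_ne_zero'
    have h21 : (-2 : ZMod p) ≠ 1 := fun h => h3 (by linear_combination -h)
    have h2m : (-2 : ZMod p) ≠ -1 := fun h => one_ne_zero (α := ZMod p) (by linear_combination -h)
    rw [secB_of_ne h20 h21 h2m, map_one, mul_one] at h
    have := h.mul_left (Commute.refl (π (genB p))).inv_left
    simpa using this

theorem exists_isAt (i : ZMod p) {x : GSGroup p} (hx : x ∈ commutator (GSGroup p)) :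
    ∃ y ∈ commutator (GSGroup p), IsAt i x y := commutator_le_ristSub i hx

instance : Group.FG (GSGroup p) :=
  Group.fg_iff.2 ⟨{genA p, genB p}, closure_generators, Set.toFinite _⟩

theorem isOfFinOrder (g : GSGroup p) : IsOfFinOrder g := by
  obtain ⟨k, hk⟩ := isPGroup g
  exact isOfFinOrder_iff_pow_eq_one.2 ⟨p ^ k, pow_pos (Fact.out : p.Prime).pos _, hk⟩

instance : (commutator (GSGroup p)).FiniteIndex := finiteIndex_commutator_of_torsion isOfFinOrder

theorem finiteIndex_commutator_commutator :
    ((commutator (commutator (GSGroup p))).map (commutator (GSGroup p)).subtype).FiniteIndex := by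
  have : (commutator (commutator (GSGroup p))).FiniteIndex :=
    finiteIndex_commutator_of_torsion fun x =>
      (Submonoid.isOfFinOrder_coe).1 (isOfFinOrder (x : GSGroup p))
  constructor
  rw [Subgroup.index_map_subtype]
  exact mul_ne_zero this.1 (inferInstance : (commutator (GSGroup p)).FiniteIndex).1

theorem commutator_commutator_le {N : Subgroup (GSGroup p)}
    (h : ∀ x ∈ commutator (GSGroup p), ∀ y ∈ commutator (GSGroup p), ⁅x, y⁆ ∈ N) :
    (commutator (commutator (GSGroup p))).map (commutator (GSGroup p)).subtype ≤ N := by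
  rw [Subgroup.map_le_iff_le_comap, commutator_def (commutator (GSGroup p)),
    Subgroup.commutator_le]
  intro x _ y _
  exact h x x.2 y y.2

/-! ### Just infiniteness -/

/-- The hypothesis on double commutators is weaker than `g ∈ N` and is inherited by sections: for
`X`, `Y` supported at `i`, the element `⁅⁅g, X⁆, Y⁆` is supported at `i`. One descends until `g`
moves the first level. -/
theorem finiteIndex_of_not_levelStab (n : ℕ) {g : GSGroup p} (hg : ¬ LevelStab n g)
    {N : Subgroup (GSGroup p)} (hN : N.Normal)
    (h : ∀ x ∈ commutator (GSGroup p), ∀ y ∈ commutator (GSGroup p), ⁅⁅g, x⁆, y⁆ ∈ N) :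
    N.FiniteIndex := by
  induction n generalizing g N with
  | zero => exact absurd trivial hg
  | succ n ih =>
    by_cases hr : rot g = 0
    · have : ∃ i, ¬ LevelStab n (sec g i) := by
        by_contra! hall
        exact hg ⟨hr, hall⟩
      obtain ⟨i, hi⟩ := this
      refine finiteIndex_of_ristSub hN (ih hi (ristSub_normal hN i) fun x hx y hy => ?_)
      obtain ⟨X, hX, hX1, hX2, hX3⟩ := exists_isAt i hx
      obtain ⟨Y, hY, hY1, hY2, hY3⟩ := exists_isAt i hy
      refine ⟨_, h X hX Y hY, rot_commutatorElement _ _, ?_, fun j hj => ?_⟩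
      · rw [sec_commutatorElement (rot_commutatorElement _ _) hY1, sec_commutatorElement hr hX1,
          hX2, hY2]
      · rw [sec_commutatorElement (rot_commutatorElement _ _) hY1, hY3 j hj,
          commutatorElement_one_right]
    -- Here `⁅g, X⁆` lives at the two letters `0` and `rot g`. Its section at `0` is the inverse of
    -- that of `X`, hence the choice `x⁻¹`; the commutator with `Y` removes the other part.
    · have h0 := finiteIndex_commutator_commutator (p := p)
      refine finiteIndex_of_ristSub hN (i := 0) (Subgroup.finiteIndex_of_le
        (commutator_commutator_le fun x hx y hy => ?_))
      obtain ⟨X, hX, hX1, hX2, hX3⟩ := exists_isAt 0 (inv_mem hx)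
      obtain ⟨Y, hY, hY1, hY2, hY3⟩ := exists_isAt 0 hy
      refine ⟨_, h X hX Y hY, rot_commutatorElement _ _, ?_, fun j hj => ?_⟩
      · have h1 : sec ⁅g, X⁆ 0 = x := by
          have h2 := hX3 (-rot g) (neg_ne_zero.2 hr)
          simp [commutatorElement_def, hX1, hX2, h2]
        rw [sec_commutatorElement (rot_commutatorElement _ _) hY1, h1, hY2]
      · rw [sec_commutatorElement (rot_commutatorElement _ _) hY1, hY3 j hj,
          commutatorElement_one_right]

theorem proClosed_of_normal (C : Subgroup (GSGroup p)) (hC : C.Normal) : C.ProClosed := by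
  by_cases h : C = ⊥
  · rw [h]; exact proClosed_bot
  · obtain ⟨⟨g, hg⟩, hg'⟩ := Subgroup.ne_bot_iff_exists_ne_one.1 h
    have hg1 : g ≠ 1 := fun h => hg' (Subtype.ext h)
    have : ∃ n, ¬ LevelStab n g := by
      by_contra! hall
      exact hg1 (eq_one_of_levelStab hall)
    obtain ⟨n, hn⟩ := this
    refine Subgroup.ProClosed.of_finiteIndex (finiteIndex_of_not_levelStab n hn hC ?_)
    intro x _ y _
    have h1 : ⁅g, x⁆ ∈ C := Subgroup.commutator_le_left C ⊤
      (Subgroup.commutator_mem_commutator hg trivial)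
    exact Subgroup.commutator_le_left C ⊤ (Subgroup.commutator_mem_commutator h1 trivial)

end

end GuptaSidki

open scoped commutatorElement

namespace GuptaSidki

variable {p : ℕ} [Fact p.Prime] [hp2 : Fact (2 < p)]

/-! ### Dense subgroups -/

theorem proDense_secSub {M : Subgroup (GSGroup p)} (hM : M.ProDense) (i : ZMod p) :
    (secSub M i).ProDense :=
  (hM.subgroupOf (firstStab p)).map (secHom_surjective i)

theorem conj_mem_secSub {M : Subgroup (GSGroup p)} {T x : GSGroup p} {i : ZMod p} (hT : T ∈ M)
    (hx : x ∈ secSub M i) : sec T i * x * (sec T i)⁻¹ ∈ secSub M (i + rot T) := by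
  obtain ⟨g, hg, h1, rfl⟩ := mem_secSub.1 hx
  refine mem_secSub.2 ⟨T * g * T⁻¹, M.mul_mem (M.mul_mem hT hg) (M.inv_mem hT), by simp [h1], ?_⟩
  simp [h1]

theorem exists_rot_eq {M : Subgroup (GSGroup p)} {g : GSGroup p} (hg : g ∈ M) (hr : rot g ≠ 0)
    (c : ZMod p) : ∃ T ∈ M, rot T = c :=
  ⟨g ^ (c / rot g).val, M.pow_mem hg _, by
    rw [rot_pow, ZMod.natCast_zmod_val, div_mul_cancel₀ _ hr]⟩

theorem exists_rot_ne_zero {M : Subgroup (GSGroup p)} (hM : M.ProDense) : ∃ g ∈ M, rot g ≠ 0 := by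
  by_contra! h
  have h1 := hM (firstStab p) h inferInstance
  have h2 : genA p ∈ firstStab p := by rw [h1]; trivial
  rw [mem_firstStab, rot_genA] at h2
  exact one_ne_zero h2

/-- Elements of `M` permute the letters transitively, so all sections of `M` are full. Density then
recombines the coordinates through `ProDense.sup_finset_inf_eq_top`. -/
theorem eq_top_of_secSub {M : Subgroup (GSGroup p)} (hM : M.ProDense) {i : ZMod p}
    (h : secSub M i = ⊤) : M = ⊤ := by
  obtain ⟨g, hg, hr⟩ := exists_rot_ne_zero hM
  have hall : ∀ j, secSub M j = ⊤ := by
    intro j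
    obtain ⟨T, hT, hTr⟩ := exists_rot_eq hg hr (j - i)
    rw [eq_top_iff]
    intro x _
    have h1 : (sec T i)⁻¹ * x * sec T i ∈ secSub M i := by rw [h]; trivial
    have h2 := conj_mem_secSub hT h1
    rw [hTr, add_sub_cancel] at h2
    simpa [mul_assoc] using h2
  have hM' := hM.subgroupOf (firstStab p)
  have h1 := hM'.sup_finset_inf_eq_top (N := fun j => (secHom (p := p) j).ker)
    (fun j => inferInstance)
    (fun j => Subgroup.quotientsResiduallyFinite_ker proClosed_of_normal (secHom_surjective j))
    (fun j => by rw [← Subgroup.comap_map_eq]; exact (congrArg _ (hall j)).trans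
                  (Subgroup.comap_top _)) Finset.univ
  have hbot : Finset.univ.inf (fun j => (secHom (p := p) j).ker) = ⊥ := by
    rw [eq_bot_iff]
    intro x hx
    rw [Finset.inf_univ_eq_iInf, Subgroup.mem_iInf] at hx
    exact eq_one_of_secHom hx
  rw [hbot, sup_bot_eq, Subgroup.subgroupOf_eq_top] at h1
  exact hM.eq_top (Subgroup.finiteIndex_of_le h1)

theorem secSub_le_of_genA_mem {M : Subgroup (GSGroup p)} (hA : genA p ∈ M) (i j : ZMod p) :
    secSub M i ≤ secSub M j := by
  intro x hx
  have := conj_mem_secSub (M.zpow_mem hA ((j - i).val : ℤ)) hx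
  simpa using this

/-- After conjugation `u = 1`, and `a ∈ M` makes all section groups of `M` equal. The sections of a
conjugate of `b` fixing the first level give two conjugates of `a`, up to inversion, and one of `b`
in the same group, with one pair closer together than before. -/
theorem eq_top_of_conj_generators (n : ℕ) {M : Subgroup (GSGroup p)} (hM : M.ProDense)
    {u w : GSGroup p} (hu : u * genA p * u⁻¹ ∈ M) (hw : w * genB p * w⁻¹ ∈ M)
    (hn : Len n (u⁻¹ * w)) : M = ⊤ := by
  induction n using Nat.strong_induction_on generalizing M u w with
  | _ n ih =>
  have key : ∀ (M : Subgroup (GSGroup p)), M.ProDense → genA p ∈ M → ∀ h : GSGroup p,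
      h * genB p * h⁻¹ ∈ M → Len n h → M = ⊤ := by
    intro M hM hA h hB hlen
    cases hlen with
    | base k =>
      refine eq_top_of_generators hA ?_
      have hk := M.zpow_mem hA k
      have := M.mul_mem (M.mul_mem (M.inv_mem hk) hB) hk
      simpa [mul_assoc] using this
    | @step n h e k hlen =>
      by_cases hk : (k : ZMod p) = 0
      · refine ih n (Nat.lt_succ_self n) hM (u := 1) (w := h) (by simpa using hA) ?_
          (by simpa using hlen)
        rw [zpow_eq_one_of_cast genA_pow hk] at hB
        have : h * genB p ^ e * 1 * genB p * (h * genB p ^ e * 1)⁻¹ = h * genB p * h⁻¹ := by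
          group
        rwa [this] at hB
      set r : ZMod p := rot (h * genB p ^ e * genA p ^ k) with hr
      -- This power of `a` on the left makes the conjugator fix the first level.
      set q : ℤ := ((-r).val : ℤ) with hq
      have hqr : (q : ZMod p) = -r := by simp [hq]
      have hlen' := hlen.genA_mul q
      obtain ⟨ν, hν, hνn⟩ := hlen'.exists_sum
      set y := genA p ^ q * h * genB p ^ e * genA p ^ k with hy
      have hyr : rot y = 0 := by
        have : y = genA p ^ q * (h * genB p ^ e * genA p ^ k) := by simp [hy, mul_assoc]
        rw [this, rot_mul, ← hr, rot_zpow, rot_genA, hqr]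
        ring
      have hyM : y * genB p * y⁻¹ ∈ M := by
        have h1 := M.zpow_mem hA q
        have h2 := M.mul_mem (M.mul_mem h1 hB) (M.inv_mem h1)
        convert h2 using 1
        simp only [hy, mul_assoc, mul_inv_rev]
      set μ : ZMod p → ℕ := fun i => ν (i + (k : ZMod p)) + if i + (k : ZMod p) = -1 then 1 else 0
        with hμ
      have hμs : ∀ i, Len (μ i) (sec y i) := fun i => by
        rw [hy, sec_step]
        exact (hν _).mul (len_secB_zpow _ e)
      have hμn : ∑ i, μ i ≤ n + 1 := by
        rw [sum_shift (fun i => ν i + if i = -1 then 1 else 0), Finset.sum_add_distrib]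
        simpa using hνn
      -- The last power of `b` lands at the letter `-1 - k`, which differs from `-1`.
      have hμ1 : μ (-1) ≤ n := by
        have h1 : (-1 : ZMod p) + k ≠ -1 := by simpa using hk
        simp only [hμ, if_neg h1, add_zero]
        exact (Finset.single_le_sum (f := ν) (fun _ _ => Nat.zero_le _) (Finset.mem_univ _)).trans
          hνn
      have h01 : (0 : ZMod p) ≠ 1 := zero_ne_one
      have h0m : (0 : ZMod p) ≠ -1 := fun h => one_ne_zero (α := ZMod p) (by linear_combination h)
      have h3 : μ 0 + (μ 1 + μ (-1)) ≤ n + 1 := by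
        refine le_trans ?_ hμn
        have := Finset.sum_le_sum_of_subset (f := μ)
          (Finset.subset_univ ({0, 1, -1} : Finset (ZMod p)))
        rwa [Finset.sum_insert (by simp [h01, h0m]), Finset.sum_insert (by simp [one_ne_neg_one]),
          Finset.sum_singleton] at this
      have hsec : ∀ i, sec y i * secB i * (sec y i)⁻¹ ∈ secSub M 0 := fun i => by
        refine secSub_le_of_genA_mem hA i 0 (mem_secSub.2 ⟨_, hyM, by simp, ?_⟩)
        simp [hyr]
      have ha0 := hsec 0
      have ha1 := (secSub M 0).inv_mem (hsec 1)
      have hb := hsec (-1)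
      rw [secB_zero] at ha0
      rw [secB_one] at ha1
      rw [secB_neg_one] at hb
      have ha1' : sec y 1 * genA p * (sec y 1)⁻¹ ∈ secSub M 0 := by
        convert ha1 using 1
        group
      have hD := proDense_secSub hM 0
      refine eq_top_of_secSub hM (i := 0) ?_
      -- Otherwise letters `0` and `-1` use up the whole length, so `μ 1 = 0` and the bound on `μ
      -- (-1)` is enough.
      by_cases hc : μ 0 + μ (-1) ≤ n
      · exact ih _ (Nat.lt_succ_of_le hc) hD ha0 hb ((hμs 0).inv.mul (hμs (-1)))
      · exact ih _ (Nat.lt_succ_of_le (by omega)) hD ha1' hb ((hμs 1).inv.mul (hμs (-1)))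
  have hs : Function.Surjective (MulAut.conj u⁻¹).toMonoidHom := (MulAut.conj u⁻¹).surjective
  have h1 := key (M.map (MulAut.conj u⁻¹).toMonoidHom) (hM.map hs)
    ⟨_, hu, by simp [mul_assoc]⟩ (u⁻¹ * w) ⟨_, hw, by simp [mul_assoc]⟩ hn
  rw [eq_top_iff]
  intro x _
  have h2 : (MulAut.conj u⁻¹).toMonoidHom x ∈ M.map (MulAut.conj u⁻¹).toMonoidHom := by
    rw [h1]; trivial
  obtain ⟨z, hz, hzx⟩ := h2
  exact (MulAut.conj u⁻¹).injective hzx ▸ hz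

theorem exists_zpow_genB {e : ℤ} (he : (e : ZMod p) ≠ 0) : ∃ m : ℤ, (genB p ^ e) ^ m = genB p := by
  refine ⟨(((e : ZMod p)⁻¹).val : ℤ), ?_⟩
  have : ((e * (((e : ZMod p)⁻¹).val : ℤ) - 1 : ℤ) : ZMod p) = 0 := by
    push_cast
    rw [ZMod.natCast_zmod_val, mul_inv_cancel₀ he, sub_self]
  have h := zpow_eq_one_of_cast genB_pow this
  rw [zpow_sub_one, mul_inv_eq_one] at h
  rw [← zpow_mul, h]

/-- The `b`-exponents of the sections add up to that of `y`, so some section is a shorter element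
with nonzero exponent. -/
theorem eq_top_of_bexp_ne_zero (n : ℕ) {M : Subgroup (GSGroup p)} (hM : M.ProDense)
    {y : GSGroup p} (hy : y ∈ M) (hr : rot y = 0) (hb : bexp y ≠ 0) (hn : Len n y) : M = ⊤ := by
  induction n using Nat.strong_induction_on generalizing M y with
  | _ n ih =>
  rcases lt_or_ge 1 n with h1 | h1
  · have : ∃ i, bexp (sec y i) ≠ 0 := by
      by_contra! h
      exact hb (by rw [← sum_bexp_sec]; simp [h])
    obtain ⟨i, hi⟩ := this
    have hl := hn.half i
    have hlt : (n + 1) / 2 < n := by omega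
    have hz : sec y i ∈ secSub M i := mem_secSub.2 ⟨y, hy, hr, rfl⟩
    have hD := proDense_secSub hM i
    refine eq_top_of_secSub hM (i := i) ?_
    by_cases hzr : rot (sec y i) = 0
    · exact ih _ hlt hD hz hzr hi hl
    -- When the section moves the first level, a section of its `p`-th power replaces it, with the
    -- same exponent and no greater length.
    · obtain ⟨h2, h3, h4⟩ := sec_pow_p hl hzr 0
      refine eq_top_of_secSub hD (i := 0) (ih _ hlt (proDense_secSub hD 0)
        (mem_secSub.2 ⟨_, (secSub M i).pow_mem hz p, by simp, rfl⟩) h3 (by rwa [h4]) h2)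
  · have hn' := hn.mono h1
    cases hn' with
    | @step _ _ e k h =>
    cases h with
    | base l =>
    have hlk : ((l + k : ℤ) : ZMod p) = 0 := by simpa using hr
    have he : (e : ZMod p) ≠ 0 := by simpa using hb
    have hk : genA p ^ k = (genA p ^ l)⁻¹ := by
      rw [eq_inv_iff_mul_eq_one, ← zpow_add, add_comm]
      exact zpow_eq_one_of_cast genA_pow hlk
    rw [hk] at hy
    obtain ⟨m, hm⟩ := exists_zpow_genB he
    have hB : genA p ^ l * genB p * (genA p ^ l)⁻¹ ∈ M := by
      have := M.zpow_mem hy m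
      rwa [conj_zpow, hm] at this
    have hrB : rot (genA p ^ l * genB p * (genA p ^ l)⁻¹) = 0 := by simp
    have hsB : ∀ i, sec (genA p ^ l * genB p * (genA p ^ l)⁻¹) i = secB (i - (l : ZMod p)) := fun i => by
      rw [← zpow_neg, sec_mul, sec_mul, sec_genA_zpow, sec_genA_zpow, one_mul, mul_one, rot_zpow,
        rot_genA]
      simp [sub_eq_add_neg]
    -- Now `M` contains a conjugate of `b`, with sections `a` at `l` and `b` at `l - 1`. An element
    -- of rotation `1` carries the latter to `l` as a conjugate of `b`.
    obtain ⟨g, hg, hgr⟩ := exists_rot_ne_zero hM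
    obtain ⟨T, hT, hTr⟩ := exists_rot_eq hg hgr 1
    have hA : genA p ∈ secSub M (l : ZMod p) := mem_secSub.2 ⟨_, hB, hrB, by rw [hsB]; simp⟩
    have hBm : genB p ∈ secSub M ((l : ZMod p) - 1) :=
      mem_secSub.2 ⟨_, hB, hrB, by rw [hsB]; simp⟩
    have hBc := conj_mem_secSub hT hBm
    rw [hTr, sub_add_cancel] at hBc
    obtain ⟨m, hm⟩ := Len.exists_len (1⁻¹ * sec T ((l : ZMod p) - 1))
    exact eq_top_of_secSub hM (eq_top_of_conj_generators m (proDense_secSub hM _) (u := 1)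
      (by simpa using hA) hBc hm)

/-- The exponent of `b` as a homomorphism. -/
noncomputable def bexpHom (p : ℕ) [Fact p.Prime] : GSGroup p →* Multiplicative (ZMod p) where
  toFun g := Multiplicative.ofAdd (bexp g)
  map_one' := by simp
  map_mul' g h := by simp

theorem mem_ker_bexpHom {g : GSGroup p} : g ∈ (bexpHom p).ker ↔ bexp g = 0 := by
  simp [MonoidHom.mem_ker, bexpHom]

/-- If `bexp` vanished on `M ⊓ firstStab`, which is dense in `firstStab`, it would vanish at `b`. -/
theorem eq_top_of_proDense {M : Subgroup (GSGroup p)} (hM : M.ProDense) : M = ⊤ := by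
  have hM' := hM.subgroupOf (firstStab p)
  have : ∃ y ∈ M, rot y = 0 ∧ bexp y ≠ 0 := by
    by_contra! h
    have h1 := hM' ((bexpHom p).ker.subgroupOf (firstStab p)) (fun x hx =>
      mem_ker_bexpHom.2 (h x hx x.2)) (Subgroup.finiteIndex_comap inferInstance _)
    have h2 : (⟨genB p, rot_genB⟩ : firstStab p) ∈ (bexpHom p).ker.subgroupOf (firstStab p) := by
      rw [h1]; trivial
    have h3 : bexp (genB p) = 0 := mem_ker_bexpHom.1 h2
    rw [bexp_genB] at h3
    exact one_ne_zero h3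
  obtain ⟨y, hy, hr, hb⟩ := this
  obtain ⟨n, hn⟩ := Len.exists_len y
  exact eq_top_of_bexp_ne_zero n hM hy hr hb hn

theorem groupIsTame : GroupIsTame (GSGroup p) :=
  ⟨fun _ => eq_top_of_proDense, proClosed_of_normal⟩

/-! ### Subgroups of finite index -/

/-- `M ⊓ firstStab` has finite index in `M` and is a subdirect product of the section groups. -/
theorem groupIsTame_of_secSub {M : Subgroup (GSGroup p)} (h : ∀ i, GroupIsTame (secSub M i)) :
    GroupIsTame M := by
  have hfin : ((firstStab p).subgroupOf M).FiniteIndex :=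
    Subgroup.finiteIndex_comap inferInstance _
  let f : ∀ i, (firstStab p).subgroupOf M →* secSub M i := fun i =>
    { toFun := fun x => ⟨sec (x : M) i, mem_secSub.2 ⟨_, (x : M).2, x.2, rfl⟩⟩
      map_one' := Subtype.ext (by simp)
      map_mul' := fun x y => Subtype.ext (by
        have hy : rot ((y : M) : GSGroup p) = 0 := y.2
        simp [hy]) }
  refine GroupIsTame.of_subgroup (L := (firstStab p).subgroupOf M)
    (GroupIsTame.of_subdirect h f (fun i => ?_) fun x hx => ?_)
  · rintro ⟨x, hx⟩
    obtain ⟨g, hg, h1, h2⟩ := mem_secSub.1 hx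
    exact ⟨⟨⟨g, hg⟩, h1⟩, Subtype.ext h2⟩
  · exact Subtype.ext (Subtype.ext (wreath_eq_one x.2 fun i => congrArg Subtype.val (hx i)))

theorem conj_mem_secSub_of_normal {N : Subgroup (GSGroup p)} (hN : N.Normal) (T : GSGroup p)
    {x : GSGroup p} {i : ZMod p} (hx : x ∈ secSub N i) :
    sec T i * x * (sec T i)⁻¹ ∈ secSub N (i + rot T) := by
  obtain ⟨g, hg, h1, rfl⟩ := mem_secSub.1 hx
  exact mem_secSub.2 ⟨T * g * T⁻¹, hN.conj_mem _ hg _, by simp [h1], by simp [h1]⟩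

theorem secSub_eq_of_normal {N : Subgroup (GSGroup p)} (hN : N.Normal) (i j : ZMod p) :
    secSub N i = secSub N j := by
  have key : ∀ i j, secSub N i ≤ secSub N j := fun i j x hx => by
    have := conj_mem_secSub_of_normal hN (genA p ^ ((j - i).val : ℤ)) hx
    simpa using this
  exact le_antisymm (key i j) (key j i)

theorem secSub_normal {N : Subgroup (GSGroup p)} (hN : N.Normal) (i : ZMod p) :
    (secSub N i).Normal := by
  constructor
  intro x hx g
  obtain ⟨T, h1, rfl⟩ := exists_sec_eq i g
  simpa [h1] using conj_mem_secSub_of_normal hN T hx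

theorem groupIsTame_of_normal {N : Subgroup (GSGroup p)} (hN : N.Normal)
    (h : GroupIsTame (secSub N 0)) : GroupIsTame N :=
  groupIsTame_of_secSub fun i => by rwa [secSub_eq_of_normal hN i 0]

theorem groupIsTame_of_eq_top {N : Subgroup (GSGroup p)} (h : N = ⊤) : GroupIsTame N := by
  subst h
  exact groupIsTame.of_mulEquiv Subgroup.topEquiv.symm

/-- The sections at `1` and `0` are `a⁻²` and `a b⁻¹`; these generate because `p` is odd. -/
theorem secSub_eq_top_of_mem {N : Subgroup (GSGroup p)} (hN : N.Normal)
    (h : conjB 0 * (conjB 1)⁻¹ ∈ N) : secSub N 0 = ⊤ := by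
  have hs : ∀ i, secB i * (secB (i - 1))⁻¹ ∈ secSub N 0 := fun i => by
    rw [secSub_eq_of_normal hN 0 i]
    exact mem_secSub.2 ⟨_, h, by simp, by simp⟩
  have h1 := hs 1
  have h0 := hs 0
  rw [sub_self, secB_one, secB_zero] at h1
  rw [zero_sub, secB_zero, secB_neg_one] at h0
  have hA : genA p ∈ secSub N 0 := by
    have hm : ∃ m : ℤ, ((genA p)⁻¹ * (genA p)⁻¹) ^ m = genA p := by
      refine ⟨(((-2 : ZMod p)⁻¹).val : ℤ), ?_⟩
      have h2 : (((-2) * (((-2 : ZMod p)⁻¹).val : ℤ) - 1 : ℤ) : ZMod p) = 0 := by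
        push_cast
        rw [ZMod.natCast_zmod_val, mul_inv_cancel₀ (neg_ne_zero.2 two_ne_zero'), sub_self]
      have h := zpow_eq_one_of_cast genA_pow h2
      rw [zpow_sub_one, mul_inv_eq_one, zpow_mul] at h
      convert h using 2
      rw [zpow_neg]
      simp [pow_two, zpow_ofNat]
    obtain ⟨m, hm⟩ := hm
    rw [← hm]
    exact (secSub N 0).zpow_mem h1 m
  refine eq_top_of_generators hA ?_
  have := (secSub N 0).mul_mem ((secSub N 0).inv_mem h0) hA
  simpa using this

theorem conjB_mem_commutator : conjB 0 * (conjB 1)⁻¹ ∈ commutator (GSGroup p) :=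
  mem_commutator_of_eq_zero (by simp) (by simp [conjB])

/-- A sequence of elements with disjoint supports. -/
theorem exists_spine : ∃ t : ℕ → GSGroup p, IsAt 1 (conjB 0 * (conjB 1)⁻¹) (t 0) ∧
    ∀ n, IsAt 0 (t n) (t (n + 1)) := by
  obtain ⟨y, hy, h0⟩ := exists_isAt 1 (conjB_mem_commutator (p := p))
  choose δ hδ hat using fun x : commutator (GSGroup p) => exists_isAt 0 x.2
  let t : ℕ → commutator (GSGroup p) := fun n => Nat.rec ⟨y, hy⟩ (fun _ x => ⟨δ x, hδ x⟩) n
  exact ⟨fun n => (t n).1, h0, fun n => hat (t n)⟩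

/-- By pigeonhole two terms of the spine agree modulo `N`. Sections at `0` lower both indices until
the smaller is zero; then a section at `1` isolates the element needed in `secSub_eq_top_of_mem`. -/
theorem groupIsTame_of_finiteIndex_normal {N : Subgroup (GSGroup p)} (hN : N.Normal)
    (hf : N.FiniteIndex) : GroupIsTame N := by
  obtain ⟨t, h0, hs⟩ := exists_spine (p := p)
  have key : ∀ n d, ∀ N : Subgroup (GSGroup p), N.Normal → (t n)⁻¹ * t (n + 1 + d) ∈ N →
      GroupIsTame N := by
    intro n
    induction n with
    | zero =>
      intro d N hN h
      refine groupIsTame_of_normal hN ?_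
      have hN0 := secSub_normal hN 0
      refine groupIsTame_of_normal hN0 (groupIsTame_of_eq_top (secSub_eq_top_of_mem hN0 ?_))
      rw [secSub_eq_of_normal hN 0 1, ← inv_mem_iff]
      obtain ⟨h1, h2, _⟩ := h0
      have hd := hs (0 + d)
      rw [show 0 + d + 1 = 0 + 1 + d by ring] at hd
      obtain ⟨h1', _, h3'⟩ := hd
      refine mem_secSub.2 ⟨_, h, by simp [h1, h1'], ?_⟩
      rw [sec_mul, h3' 1 one_ne_zero, sec_inv, h1, h1', add_zero, sub_zero, h2, mul_one]
    | succ n ih =>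
      intro d N hN h
      refine groupIsTame_of_normal hN (ih d _ (secSub_normal hN 0) ?_)
      obtain ⟨h1, h2, _⟩ := hs n
      have hd := hs (n + 1 + d)
      rw [show n + 1 + d + 1 = n + 1 + 1 + d by ring] at hd
      obtain ⟨h1', h2', _⟩ := hd
      refine mem_secSub.2 ⟨_, h, by simp [h1, h1'], ?_⟩
      rw [sec_mul, h2', sec_inv, h1, h1', add_zero, sub_zero, h2]
  have : Finite (GSGroup p ⧸ N) := Subgroup.finite_quotient_of_finiteIndex
  obtain ⟨n, m, hnm, h⟩ := Finite.exists_ne_map_eq_of_infinite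
    (fun n => (QuotientGroup.mk (t n) : GSGroup p ⧸ N))
  rcases lt_or_gt_of_ne hnm with hlt | hlt
  · obtain ⟨d, rfl⟩ := Nat.exists_eq_add_of_le (Nat.succ_le_of_lt hlt)
    exact key n d N hN (QuotientGroup.eq.1 h)
  · obtain ⟨d, rfl⟩ := Nat.exists_eq_add_of_le (Nat.succ_le_of_lt hlt)
    exact key m d N hN (QuotientGroup.eq.1 h.symm)

theorem groupIsTame_of_finiteIndex {M : Subgroup (GSGroup p)} (hM : M.FiniteIndex) :
    GroupIsTame M :=
  GroupIsTame.of_le (Subgroup.normalCore_le M)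
    (Subgroup.relIndex_ne_zero_of_index_ne_zero inferInstance _)
    (groupIsTame_of_finiteIndex_normal (N := M.normalCore) inferInstance inferInstance)

theorem groupIsTame_of_abstractlyCommensurable {k : ℕ} {H : Type*} [Group H]
    (h : AbstractlyCommensurable H (Fin k → GSGroup p)) : GroupIsTame H := by
  obtain ⟨K, L, hK, hL, ⟨e⟩⟩ := h
  have hsurj : ∀ i, Function.Surjective (Pi.evalMonoidHom (fun _ : Fin k => GSGroup p) i) :=
    fun i x => ⟨fun _ => x, rfl⟩
  have hLt : GroupIsTame L := by
    refine GroupIsTame.of_subdirect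
      (A := fun i => L.map (Pi.evalMonoidHom (fun _ : Fin k => GSGroup p) i))
      (fun i => groupIsTame_of_finiteIndex ⟨?_⟩)
      (fun i => (Pi.evalMonoidHom (fun _ : Fin k => GSGroup p) i).subgroupMap L)
      (fun i => MonoidHom.subgroupMap_surjective _ _) fun x hx => ?_
    · exact ne_zero_of_dvd_ne_zero hL.1 (Subgroup.index_map_dvd _ (hsurj i))
    · exact Subtype.ext (funext fun i => congrArg Subtype.val (hx i))
  exact GroupIsTame.of_subgroup (hLt.of_mulEquiv e.symm)

end GuptaSidki

/-! ### Finitely generated subgroups -/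

open scoped commutatorElement

/-- A maximal subgroup of a finite `p`-group contains the commutator subgroup. -/
theorem IsPGroup.commutatorElement_mem_of_isCoatom {p : ℕ} [Fact p.Prime] {Q : Type*} [Group Q]
    [Finite Q] (hQ : IsPGroup p Q) {M : Subgroup Q} (hM : IsCoatom M) (x y : Q) : ⁅x, y⁆ ∈ M := by
  have : Group.IsNilpotent Q := hQ.isNilpotent
  have hn : M.Normal := Subgroup.NormalizerCondition.normal_of_coatom M
    Group.normalizerCondition_of_isNilpotent hM
  have hnt : Nontrivial (Q ⧸ M) := QuotientGroup.nontrivial_iff.2 hM.1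
  have hlt : commutator (Q ⧸ M) < ⊤ := Group.IsSolvable.commutator_lt_top_of_nontrivial _
  have hle : M ≤ (commutator (Q ⧸ M)).comap (QuotientGroup.mk' M) := fun z hz => by
    have : QuotientGroup.mk' M z = 1 := (QuotientGroup.eq_one_iff z).2 hz
    rw [Subgroup.mem_comap, this]
    exact Subgroup.one_mem _
  have heq : (commutator (Q ⧸ M)).comap (QuotientGroup.mk' M) = M := by
    rcases eq_or_lt_of_le hle with h | h
    · exact h.symm
    · exfalso
      have h1 := hM.2 _ h
      refine hlt.ne ?_
      rw [← Subgroup.map_comap_eq_self_of_surjective (QuotientGroup.mk'_surjective M)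
        (commutator (Q ⧸ M)), h1]
      exact Subgroup.map_top_of_surjective _ (QuotientGroup.mk'_surjective M)
  rw [← heq, Subgroup.mem_comap, map_commutatorElement]
  exact Subgroup.commutator_mem_commutator trivial trivial

namespace GuptaSidki

section

variable {p : ℕ} [Fact p.Prime] [hp2 : Fact (2 < p)]

/-- The subgroup `M` maps onto the abelianization of the Gupta–Sidki group. -/
def IsFull (M : Subgroup (GSGroup p)) : Prop :=
  ∃ u ∈ M, ∃ w ∈ M, rot u * bexp w - rot w * bexp u ≠ 0

/-- A Frattini argument: a proper subgroup of finite index lies in the preimage of a maximal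
subgroup of a finite `p`-quotient, which contains all commutators. So a full `M` is dense. -/
theorem IsFull.eq_top {M : Subgroup (GSGroup p)} (hM : IsFull M) : M = ⊤ := by
  refine eq_top_of_proDense fun F hF hfin => ?_
  by_contra hne
  have : Finite (GSGroup p ⧸ F.normalCore) := Subgroup.finite_quotient_of_finiteIndex
  set π := QuotientGroup.mk' F.normalCore with hπ
  have hker : π.ker ≤ F := by rw [hπ, QuotientGroup.ker_mk']; exact Subgroup.normalCore_le F
  have hmap : F.map π ≠ ⊤ := fun h => hne (by
    rw [← Subgroup.comap_map_eq_self hker, h, Subgroup.comap_top])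
  obtain ⟨P, hP, hFP⟩ := (eq_top_or_exists_le_coatom (F.map π)).resolve_left hmap
  have hc : commutator (GSGroup p) ≤ P.comap π := by
    rw [commutator_def, Subgroup.commutator_le]
    intro x _ y _
    rw [Subgroup.mem_comap, map_commutatorElement]
    exact (isPGroup.to_quotient F.normalCore).commutatorElement_mem_of_isCoatom hP _ _
  have hMP : M ≤ P.comap π := hF.trans (Subgroup.map_le_iff_le_comap.1 hFP)
  obtain ⟨u, hu, w, hw, hd⟩ := hM
  refine hP.1 ?_
  rw [← Subgroup.map_comap_eq_self_of_surjective (QuotientGroup.mk'_surjective F.normalCore) P]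
  have : P.comap π = ⊤ := by
    rw [eq_top_iff]
    intro g _
    set d := rot u * bexp w - rot w * bexp u
    -- Cramer's rule for `u ^ i * w ^ j` to agree with `g` in the abelianization.
    set i := (rot g * bexp w - bexp g * rot w) / d with hi
    set j := (rot u * bexp g - bexp u * rot g) / d with hj
    set h := u ^ (i.val : ℤ) * w ^ (j.val : ℤ) with hh
    have hhM : h ∈ M := M.mul_mem (M.zpow_mem hu _) (M.zpow_mem hw _)
    have hr : rot h = rot g := by
      rw [hh, rot_mul, rot_zpow, rot_zpow]
      push_cast
      rw [ZMod.natCast_zmod_val, ZMod.natCast_zmod_val, hi, hj]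
      field_simp
      simp only [d]
      ring
    have hb : bexp h = bexp g := by
      rw [hh, bexp_mul, bexp_zpow, bexp_zpow]
      push_cast
      rw [ZMod.natCast_zmod_val, ZMod.natCast_zmod_val, hi, hj]
      field_simp
      simp only [d]
      ring
    have h1 : g * h⁻¹ ∈ P.comap π :=
      hc (mem_commutator_of_eq_zero (by simp [hr]) (by simp [hb]))
    simpa using (P.comap π).mul_mem h1 (hMP hhM)
  rw [this]
  exact Subgroup.map_top_of_surjective _ (QuotientGroup.mk'_surjective _)

/-! ### Hereditarily tame subgroups -/

/-- All subgroups of finite index of `H` are tame. -/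
def IsHereditarilyTame (H : Subgroup (GSGroup p)) : Prop :=
  ∀ K ≤ H, K.relIndex H ≠ 0 → GroupIsTame K

theorem isHereditarilyTame_top : IsHereditarilyTame (⊤ : Subgroup (GSGroup p)) := fun K _ hK =>
  groupIsTame_of_finiteIndex ⟨by rwa [Subgroup.relIndex_top_right] at hK⟩

theorem isHereditarilyTame_of_finite {H : Subgroup (GSGroup p)} (h : Finite H) :
    IsHereditarilyTame H := fun K hK _ => by
  have : Finite K := Finite.of_injective _ (Subgroup.inclusion_injective hK)
  exact GroupIsTame.of_finite

theorem isHereditarilyTame_of_le_zpowers {H : Subgroup (GSGroup p)} {x : GSGroup p}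
    (h : H ≤ Subgroup.zpowers x) : IsHereditarilyTame H := by
  have : Finite (Subgroup.zpowers x) := (isOfFinOrder x).finite_zpowers
  exact isHereditarilyTame_of_finite (Finite.of_injective _ (Subgroup.inclusion_injective h))

theorem IsHereditarilyTame.conj {H : Subgroup (GSGroup p)} (h : IsHereditarilyTame H)
    (g : GSGroup p) : IsHereditarilyTame (H.map (MulAut.conj g).toMonoidHom) := by
  intro K hK hr
  have hs : Function.Surjective (MulAut.conj g).toMonoidHom := (MulAut.conj g).surjective
  have hi : Function.Injective (MulAut.conj g).toMonoidHom := (MulAut.conj g).injective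
  have h1 : K.comap (MulAut.conj g).toMonoidHom ≤ H := by
    rw [← Subgroup.comap_map_eq_self_of_injective hi H]
    exact Subgroup.comap_mono hK
  have h2 := h _ h1 (by rwa [Subgroup.relIndex_comap])
  have h3 := h2.of_mulEquiv
    ((K.comap (MulAut.conj g).toMonoidHom).equivMapOfInjective _ hi)
  rwa [Subgroup.map_comap_eq_self_of_surjective hs] at h3

theorem isHereditarilyTame_of_secSub {H : Subgroup (GSGroup p)}
    (h : ∀ i, IsHereditarilyTame (secSub H i)) : IsHereditarilyTame H := by
  intro K hK hr
  refine groupIsTame_of_secSub fun i => h i _ ?_ ?_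
  · exact Subgroup.map_mono (Subgroup.comap_mono hK)
  · unfold secSub
    rw [← Subgroup.relIndex_comap]
    exact ne_zero_of_dvd_ne_zero (Subgroup.relIndex_comap_ne_zero (firstStab p).subtype hr)
      (Subgroup.relIndex_dvd_of_le_left _ (Subgroup.le_comap_map _ _))

/-- Powers of `g` move `c` to every letter, so all section groups are conjugate. -/
theorem isHereditarilyTame_of_secSub_one {H : Subgroup (GSGroup p)} {g : GSGroup p} (hg : g ∈ H)
    (hr : rot g ≠ 0) {c : ZMod p} (h : IsHereditarilyTame (secSub H c)) :
    IsHereditarilyTame H := by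
  refine isHereditarilyTame_of_secSub fun j => ?_
  obtain ⟨T, hT, hTr⟩ := exists_rot_eq hg hr (j - c)
  have : (secSub H c).map (MulAut.conj (sec T c)).toMonoidHom = secSub H j := by
    refine le_antisymm ?_ ?_
    · rintro _ ⟨x, hx, rfl⟩
      have h1 := conj_mem_secSub hT hx
      rw [hTr, add_sub_cancel] at h1
      exact h1
    · intro x hx
      have h1 := conj_mem_secSub (H.inv_mem hT) hx
      rw [rot_inv, hTr, sec_inv, hTr, sub_sub_cancel, neg_sub, add_sub_cancel] at h1
      exact Subgroup.mem_map.2 ⟨_, h1, by simp [mul_assoc]⟩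
  rw [← this]
  exact h.conj _

/-- `H` is generated by elements of length at most `n`. -/
def GenBy (n : ℕ) (H : Subgroup (GSGroup p)) : Prop :=
  H ≤ Subgroup.closure {s | s ∈ H ∧ Len n s}

theorem exists_genBy {H : Subgroup (GSGroup p)} (hH : H.FG) : ∃ n, GenBy n H := by
  obtain ⟨S, hS⟩ := hH
  choose ℓ hℓ using Len.exists_len (p := p)
  refine ⟨S.sup ℓ, ?_⟩
  have hsub : (S : Set (GSGroup p)) ⊆ {s | s ∈ H ∧ Len (S.sup ℓ) s} := fun s hs =>
    ⟨hS ▸ Subgroup.subset_closure hs, (hℓ s).mono (Finset.le_sup (f := ℓ) hs)⟩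
  intro x hx
  rw [← hS] at hx
  exact Subgroup.closure_mono hsub hx

theorem secSub_le_closure {H : Subgroup (GSGroup p)} {n : ℕ} (hH : H ≤ firstStab p)
    (hn : GenBy n H) (i : ZMod p) :
    secSub H i ≤ Subgroup.closure ((fun s => sec s i) '' {s | s ∈ H ∧ Len n s}) := by
  set C := Subgroup.closure ((fun s => sec s i) '' {s | s ∈ H ∧ Len n s}) with hC
  have key : H ≤ (C.comap (secHom i)).map (firstStab p).subtype := by
    refine hn.trans ((Subgroup.closure_le _).2 fun s hs => ?_)
    exact ⟨⟨s, hH hs.1⟩, Subgroup.subset_closure ⟨s, hs, rfl⟩, rfl⟩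
  intro x hx
  obtain ⟨g, hg, _, rfl⟩ := mem_secSub.1 hx
  obtain ⟨y, hy, rfl⟩ := key hg
  exact hy

theorem GenBy.secSub {H : Subgroup (GSGroup p)} {n : ℕ} (hn : GenBy n H) (hH : H ≤ firstStab p)
    (i : ZMod p) : GenBy ((n + 1) / 2) (secSub H i) := by
  refine (secSub_le_closure hH hn i).trans (Subgroup.closure_mono ?_)
  rintro _ ⟨s, hs, rfl⟩
  exact ⟨mem_secSub.2 ⟨s, hs.1, hH hs.1, rfl⟩, hs.2.half i⟩

theorem secB_mem_zpowers (i : ZMod p) :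
    secB i ∈ Subgroup.zpowers (genA p) ∨ secB i ∈ Subgroup.zpowers (genB p) := by
  by_cases h2 : i = -1
  · right; rw [h2, secB_neg_one]; exact Subgroup.mem_zpowers _
  left
  by_cases h0 : i = 0
  · rw [h0, secB_zero]; exact Subgroup.mem_zpowers _
  by_cases h1 : i = 1
  · rw [h1, secB_one]; exact Subgroup.inv_mem _ (Subgroup.mem_zpowers _)
  rw [secB_of_ne h0 h1 h2]; exact Subgroup.one_mem _

/-- Each section group is generated by powers of `a` and powers of `b`. If only one kind occurs
nontrivially it lies in a finite cyclic group; otherwise it is full. -/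
theorem isHereditarilyTame_of_genBy_one {H : Subgroup (GSGroup p)} (hH : H ≤ firstStab p)
    (hn : GenBy 1 H) : IsHereditarilyTame H := by
  refine isHereditarilyTame_of_secSub fun i => ?_
  have hgen : ∀ C : Subgroup (GSGroup p),
      (∀ x ∈ secSub H i, (x ∈ Subgroup.zpowers (genA p) ∨ x ∈ Subgroup.zpowers (genB p)) → x ∈ C) →
      secSub H i ≤ C := by
    intro C hC
    refine (secSub_le_closure hH hn i).trans ((Subgroup.closure_le _).2 ?_)
    rintro _ ⟨s, ⟨hs, hl⟩, rfl⟩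
    refine hC _ (mem_secSub.2 ⟨s, hs, hH hs, rfl⟩) ?_
    cases hl with
    | @step _ _ e k h =>
    cases h with
    | base l =>
    simp only [sec_step, sec_genA_zpow, one_mul]
    exact (secB_mem_zpowers _).imp (fun h => Subgroup.zpow_mem _ h e)
      (fun h => Subgroup.zpow_mem _ h e)
  by_cases hA : ∃ x ∈ secSub H i, x ∈ Subgroup.zpowers (genA p) ∧ x ≠ 1
  swap
  · refine isHereditarilyTame_of_le_zpowers (x := genB p) (hgen _ fun x hx h => ?_)
    rcases h with h | h
    · by_cases hx1 : x = 1
      · rw [hx1]; exact Subgroup.one_mem _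
      · exact absurd ⟨x, hx, h, hx1⟩ hA
    · exact h
  by_cases hB : ∃ x ∈ secSub H i, x ∈ Subgroup.zpowers (genB p) ∧ x ≠ 1
  swap
  · refine isHereditarilyTame_of_le_zpowers (x := genA p) (hgen _ fun x hx h => ?_)
    rcases h with h | h
    · exact h
    · by_cases hx1 : x = 1
      · rw [hx1]; exact Subgroup.one_mem _
      · exact absurd ⟨x, hx, h, hx1⟩ hB
  obtain ⟨x, hx, ⟨k, rfl⟩, hx1⟩ := hA
  obtain ⟨y, hy, ⟨e, rfl⟩, hy1⟩ := hB
  have hk : (k : ZMod p) ≠ 0 := fun h => hx1 (zpow_eq_one_of_cast genA_pow h)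
  have he : (e : ZMod p) ≠ 0 := fun h => hy1 (zpow_eq_one_of_cast genB_pow h)
  have hfull : IsFull (secSub H i) := ⟨_, hx, _, hy, by simp [hk, he]⟩
  rw [hfull.eq_top]
  exact isHereditarilyTame_top

/-- Generators of the section of a subgroup that is transitive on the first level. -/
theorem secSub_le_closure_of_transversal {H : Subgroup (GSGroup p)} {S : Set (GSGroup p)}
    (hS : H ≤ Subgroup.closure S) {c : ZMod p} {T : ZMod p → GSGroup p} (hT1 : T c = 1) :
    secSub H c ≤ Subgroup.closure
      {x | ∃ s ∈ S, ∃ i, x = (sec (T (i + rot s)) c)⁻¹ * sec s i * sec (T i) c} := by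
  set C := Subgroup.closure
    {x | ∃ s ∈ S, ∃ i, x = (sec (T (i + rot s)) c)⁻¹ * sec s i * sec (T i) c}
  -- The Schreier rewriting holds for every starting letter `i`, so that it can be composed along a
  -- product.
  have key : ∀ h ∈ Subgroup.closure S, ∀ i,
      (sec (T (i + rot h)) c)⁻¹ * sec h i * sec (T i) c ∈ C := by
    intro h hh
    induction hh using Subgroup.closure_induction with
    | mem s hs => exact fun i => Subgroup.subset_closure ⟨s, hs, i, rfl⟩
    | one => intro i; simp
    | mul x y _ _ hx hy =>
      intro i
      have := C.mul_mem (hx (i + rot y)) (hy i)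
      rw [show i + rot y + rot x = i + rot (x * y) by rw [rot_mul]; ring] at this
      simpa [mul_assoc] using this
    | inv x _ hx =>
      intro i
      have := C.inv_mem (hx (i - rot x))
      simpa [mul_assoc, sub_eq_add_neg] using this
  intro x hx
  obtain ⟨g, hg, hr, rfl⟩ := mem_secSub.1 hx
  simpa [hr, hT1] using key g (hS hg) c

theorem transversal_mem_secSub {H : Subgroup (GSGroup p)} {c : ZMod p} {T : ZMod p → GSGroup p}
    (hT : ∀ i, T i ∈ H) (hTr : ∀ i, rot (T i) = i - c) {s : GSGroup p} (hs : s ∈ H) (i : ZMod p) :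
    (sec (T (i + rot s)) c)⁻¹ * sec s i * sec (T i) c ∈ secSub H c := by
  refine mem_secSub.2 ⟨(T (i + rot s))⁻¹ * s * T i,
    H.mul_mem (H.mul_mem (H.inv_mem (hT _)) hs) (hT i), ?_, ?_⟩
  · simp only [rot_mul, rot_inv, hTr]; ring
  · simp only [sec_mul, sec_inv, hTr]
    rw [show c + (i - c) = i by ring, show i + rot s - (i + rot s - c) = c by ring]

theorem eq_one_of_len_one {x : GSGroup p} (h : Len 1 x) (hr : rot x = 0) (hb : bexp x = 0) :
    x = 1 := by
  cases h with
  | @step _ _ e k h =>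
  cases h with
  | base l =>
  have he : (e : ZMod p) = 0 := by simpa using hb
  have hlk : ((l + k : ℤ) : ZMod p) = 0 := by simpa using hr
  rw [zpow_eq_one_of_cast genB_pow he, mul_one, ← zpow_add, zpow_eq_one_of_cast genA_pow hlk]

end

/-! ### The case of the prime three -/

section Three

instance : Fact (2 < 3) := ⟨by norm_num⟩

theorem univ_three (f : ZMod 3 → ℕ) (c : ZMod 3) :
    ∑ i, f i = f c + f (c - 1) + f (c + 1) := by
  have h1 : (Finset.univ : Finset (ZMod 3)) = {c, c - 1, c + 1} := by
    revert c
    decide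
  have h2 : c ∉ ({c - 1, c + 1} : Finset (ZMod 3)) := by
    revert c
    decide
  have h3 : c - 1 ∉ ({c + 1} : Finset (ZMod 3)) := by
    revert c
    decide
  rw [h1, Finset.sum_insert h2, Finset.sum_insert h3, Finset.sum_singleton, add_assoc]

/-- Eliminating `z`, the determinant is `(x - y) ^ 2` modulo `3`; if `x = y` then `z = -2 * x = x`.
-/
theorem det_three : ∀ x y z : ZMod 3, x + y + z = 0 → ¬ (x = y ∧ y = z) →
    (z - y) * y - (x - z) * x ≠ 0 := by decide

/-- Neither `H` nor its section is full. The first forces `bexp s = 0`. The sections of `s` occur in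
`secSub H c` up to conjugacy, so the second and `det_three` make their `b`-exponents equal;
`rot_sec` concludes. -/
theorem rot_sec_eq_zero {H : Subgroup (GSGroup 3)} (hH : H ≠ ⊤) {g : GSGroup 3} (hg : g ∈ H)
    (hr : rot g ≠ 0) {c : ZMod 3} (hc : secSub H c ≠ ⊤) {s : GSGroup 3} (hs : s ∈ H)
    (hsr : rot s = 0) (i : ZMod 3) : rot (sec s i) = 0 := by
  have hb : bexp s = 0 := by
    by_contra hb
    exact hH (IsFull.eq_top ⟨g, hg, s, hs, by simp [hsr, hr, hb]⟩)
  have hx : ∀ i, ∃ x ∈ secSub H c, rot x = rot (sec s i) ∧ bexp x = bexp (sec s i) := by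
    intro i
    obtain ⟨T, hT, hTr⟩ := exists_rot_eq hg hr (c - i)
    have h1 := conj_mem_secSub hT (mem_secSub.2 ⟨s, hs, hsr, rfl⟩ : sec s i ∈ secSub H i)
    rw [hTr, add_sub_cancel] at h1
    exact ⟨_, h1, by simp, by simp⟩
  have hsum : bexp (sec s 0) + bexp (sec s 1) + bexp (sec s 2) = 0 := by
    have := sum_bexp_sec s
    rwa [hb, show (Finset.univ : Finset (ZMod 3)) = {0, 1, 2} by decide,
      Finset.sum_insert (by decide), Finset.sum_insert (by decide), Finset.sum_singleton,
      ← add_assoc] at this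
  have hconst : bexp (sec s 0) = bexp (sec s 1) ∧ bexp (sec s 1) = bexp (sec s 2) := by
    by_contra hne
    have hd := det_three _ _ _ hsum hne
    obtain ⟨x, hxm, hx1, hx2⟩ := hx 0
    obtain ⟨y, hym, hy1, hy2⟩ := hx 1
    refine hc (IsFull.eq_top ⟨x, hxm, y, hym, ?_⟩)
    rw [hx1, hx2, hy1, hy2, rot_sec s 0, rot_sec s 1]
    exact hd
  have hall : ∀ j : ZMod 3, bexp (sec s j) = bexp (sec s 1) := by
    intro j
    fin_cases j
    · exact hconst.1
    · rfl
    · exact hconst.2.symm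
  rw [rot_sec, hall, hall (i - 2), sub_self]

/-- Two syllables over three letters leave some section a power of `a`. The `b`-exponents of the
sections agree, so all vanish, and each section has length at most one. -/
theorem eq_one_of_len_two {s : GSGroup 3} (hsr : rot s = 0) (h : ∀ i, rot (sec s i) = 0)
    (hl : Len 2 s) : s = 1 := by
  have hall : ∀ i, bexp (sec s i) = bexp (sec s (i + 1)) := fun i => by
    have h1 := h (i + 2)
    rw [rot_sec, show i + 2 - 1 = i + 1 by ring, show i + 2 - 2 = i by ring] at h1
    exact (sub_eq_zero.1 h1).symm
  obtain ⟨ν, hν, hsum⟩ := hl.exists_sum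
  have : ∃ i, ν i = 0 := by
    by_contra! hne
    rw [univ_three ν 0] at hsum
    have h0 := hne 0
    have h1 := hne (0 - 1)
    have h2 := hne (0 + 1)
    omega
  obtain ⟨i, hi⟩ := this
  have hi0 : bexp (sec s i) = 0 := by
    have h1 := hν i
    rw [hi] at h1
    generalize sec s i = x at h1
    cases h1 with
    | base k => simp
  have hz : ∀ j, bexp (sec s j) = 0 := by
    have h1 := (hall i).symm.trans hi0
    have h2 := (hall (i + 1)).symm.trans h1
    have hcov : ∀ i j : ZMod 3, j = i ∨ j = i + 1 ∨ j = i + 1 + 1 := by decide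
    intro j
    rcases hcov i j with rfl | rfl | rfl
    exacts [hi0, h1, h2]
  exact wreath_eq_one hsr fun j => eq_one_of_len_one (hl.half j) (h j) (hz j)

/-- If `H` fixes the first level, sections halve the length. If not, and `H` and its section are
proper, the Schreier generators of the section may be longer, but the section fixes the first level
and can be halved again. -/
theorem isHereditarilyTame_of_genBy (n : ℕ) {H : Subgroup (GSGroup 3)} (hn : GenBy n H) :
    IsHereditarilyTame H := by
  induction n using Nat.strong_induction_on generalizing H with
  | _ n ih =>
  by_cases htop : H = ⊤
  · rw [htop]; exact isHereditarilyTame_top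
  by_cases hst : H ≤ firstStab 3
  · rcases lt_or_ge 1 n with h1 | h1
    · exact isHereditarilyTame_of_secSub fun i => ih _ (by omega) (hn.secSub hst i)
    · exact isHereditarilyTame_of_genBy_one hst (hn.trans (Subgroup.closure_mono
        fun s hs => ⟨hs.1, hs.2.mono h1⟩))
  have hg : ∃ g ∈ H, Len n g ∧ rot g = 1 := by
    have h0 : ∃ g ∈ H, Len n g ∧ rot g ≠ 0 := by
      by_contra! h
      exact hst (hn.trans ((Subgroup.closure_le _).2 fun s hs => h s hs.1 hs.2))
    obtain ⟨g, hg, hl, hr⟩ := h0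
    have h3 : ∀ r : ZMod 3, r ≠ 0 → r = 1 ∨ -r = 1 := by decide
    rcases h3 _ hr with h | h
    · exact ⟨g, hg, hl, h⟩
    · exact ⟨g⁻¹, H.inv_mem hg, hl.inv, by rw [rot_inv, h]⟩
  obtain ⟨g, hg, hgl, hr⟩ := hg
  have hr0 : rot g ≠ 0 := by rw [hr]; exact one_ne_zero
  obtain ⟨ν, hν, hsum⟩ := hgl.exists_sum
  obtain ⟨i₀, hi₀⟩ := Finite.exists_max ν
  -- The base letter is placed so that the longest section of `g`, at `c + 1`, is not used by the
  -- transversal `1, g, g⁻¹`; the two used have length at most `n / 2`.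
  set c : ZMod 3 := i₀ - 1 with hc
  rw [univ_three ν c] at hsum
  have hm1 : ν c ≤ ν (c + 1) := by rw [hc, sub_add_cancel]; exact hi₀ _
  have hm2 : ν (c - 1) ≤ ν (c + 1) := by rw [hc, sub_add_cancel]; exact hi₀ _
  refine isHereditarilyTame_of_secSub_one hg hr0 (c := c) ?_
  by_cases hctop : secSub H c = ⊤
  · rw [hctop]; exact isHereditarilyTame_top
  have hzero := fun s hs hsr => rot_sec_eq_zero htop hg hr0 hctop (s := s) hs hsr
  have hcst : secSub H c ≤ firstStab 3 := by
    intro x hx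
    obtain ⟨s, hs, hsr, rfl⟩ := mem_secSub.1 hx
    exact hzero s hs hsr c
  set T : ZMod 3 → GSGroup 3 := fun i => if i = c then 1 else if i = c + 1 then g else g⁻¹ with hT
  set τ : ZMod 3 → ℕ := fun i => if i = c then 0 else if i = c + 1 then ν c else ν (c - 1) with hτ
  have hTH : ∀ i, T i ∈ H := fun i => by
    simp only [hT]
    split_ifs
    exacts [H.one_mem, hg, H.inv_mem hg]
  have hTr : ∀ i, rot (T i) = i - c := fun i => by
    have h3 : ∀ i c : ZMod 3, i ≠ c → i ≠ c + 1 → -1 = i - c := by decide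
    simp only [hT]
    split_ifs with h1 h2
    · rw [h1, sub_self, rot_one]
    · rw [h2, hr]; ring
    · rw [rot_inv, hr]; exact h3 i c h1 h2
  have hTl : ∀ i, Len (τ i) (sec (T i) c) := fun i => by
    simp only [hT, hτ]
    split_ifs
    · rw [sec_one]; exact Len.one
    · exact hν c
    · rw [sec_inv, hr]; exact (hν _).inv
  have hT1 : T c = 1 := by simp [hT]
  have hgen : ∀ N, (∀ s ∈ H, Len n s → ∀ i,
      Len N ((sec (T (i + rot s)) c)⁻¹ * sec s i * sec (T i) c)) → GenBy N (secSub H c) := by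
    intro N hN
    refine (secSub_le_closure_of_transversal hn hT1).trans (Subgroup.closure_mono ?_)
    rintro _ ⟨s, hs, i, rfl⟩
    exact ⟨transversal_mem_secSub hTH hTr hs.1 i, hN s hs.1 hs.2 i⟩
  have hlen : ∀ s, Len n s → ∀ i, Len (τ (i + rot s) + (n + 1) / 2 + τ i)
      ((sec (T (i + rot s)) c)⁻¹ * sec s i * sec (T i) c) := fun s hs i =>
    ((hTl _).inv.mul (hs.half i)).mul (hTl i)
  have hτ2 : ∀ i, 2 * τ i ≤ n := fun i => by
    simp only [hτ]
    split_ifs <;> omega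
  rcases lt_or_ge 2 n with h3 | h3
  · have hG := hgen ((n + 1) / 2 + 2 * (n / 2)) fun s hs hl i => (hlen s hl i).mono (by
      have := hτ2 (i + rot s)
      have := hτ2 i
      omega)
    -- The second section brings the length below `n` once `n ≥ 3`; smaller `n` need sharper bounds.
    have hlt : ((n + 1) / 2 + 2 * (n / 2) + 1) / 2 < n := by
      obtain ⟨m, rfl | rfl⟩ : ∃ m, n = 2 * m ∨ n = 2 * m + 1 := ⟨n / 2, by omega⟩ <;> omega
    exact isHereditarilyTame_of_secSub fun i => ih _ hlt (hG.secSub hcst i)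
  rcases lt_or_ge 1 n with h2 | h2
  · have hG := hgen 2 fun s hs hl i => by
      by_cases hsr : rot s = 0
      · rw [eq_one_of_len_two hsr (hzero s hs hsr) (hl.mono h3)]
        have h1 : Len 2 (1 : GSGroup 3) := Len.one.mono (by omega)
        simpa using h1
      · refine (hlen s hl i).mono ?_
        have hne : i + rot s ≠ i := by simpa using hsr
        -- The two transversal elements differ. For `n = 2`, maximality of `ν (c + 1)` gives `ν c +
        -- ν (c - 1) ≤ 1`, so the generator has length at most `2`.
        have hab : τ (i + rot s) + τ i ≤ ν c + ν (c - 1) := by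
          have hcov : ∀ i j c : ZMod 3, i ≠ j → i ≠ c → j ≠ c → i ≠ c + 1 → j = c + 1 := by decide
          generalize i + rot s = j at hne
          simp only [hτ]
          by_cases hjc : j = c
          · have hic : i ≠ c := fun h => hne (hjc.trans h.symm)
            rw [if_pos hjc, if_neg hic]
            split_ifs <;> omega
          by_cases hic : i = c
          · rw [if_neg hjc, if_pos hic]
            split_ifs <;> omega
          rw [if_neg hjc, if_neg hic]
          by_cases hi : i = c + 1
          · have hj : j ≠ c + 1 := fun h => hne (h.trans hi.symm)
            rw [if_neg hj, if_pos hi, add_comm]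
          · rw [if_pos (hcov i j c hne.symm hic hjc hi), if_neg hi]
        omega
    exact isHereditarilyTame_of_secSub fun i => ih _ (by omega) (hG.secSub hcst i)
  · refine isHereditarilyTame_of_genBy_one hcst (hgen 1 fun s hs hl i => (hlen s hl i).mono ?_)
    have := hτ2 (i + rot s)
    have := hτ2 i
    omega

end Three

end GuptaSidki

theorem mainTheorem6 :
    (∀ (p : ℕ), p.Prime → Odd p → ∀ (k : ℕ) (H : Type*) [Group H],
      AbstractlyCommensurable H (Fin k → guptaSidkiGroup p) →
        ∀ M : Subgroup H, IsCoatom M → M.FiniteIndex) ∧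
    (∀ H : Subgroup (guptaSidkiGroup 3), H.FG →
      ∀ M : Subgroup H, IsCoatom M → M.FiniteIndex) := by
  constructor
  · intro p hp hodd k H _ hH M hM
    have : Fact p.Prime := ⟨hp⟩
    have : Fact (2 < p) := ⟨lt_of_le_of_ne hp.two_le fun h => by
      subst h
      exact absurd hodd (by decide)⟩
    exact (GuptaSidki.groupIsTame_of_abstractlyCommensurable hH).finiteIndex_of_isCoatom hM
  · intro H hH M hM
    obtain ⟨n, hn⟩ := GuptaSidki.exists_genBy hH
    exact (GuptaSidki.isHereditarilyTame_of_genBy n hn H le_rfl (by simp)).finiteIndex_of_isCoatom hM
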